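/- All manifolds are smooth, Hausdorff and without boundary, all maps and forms are smooth, and $M$ is non-empty. A \emph{presymplectic form} is a closed $2$-form of maximal rank on an odd-dimensional manifold, i.e. its kernel $\{v : \iota_v\omega = 0\}$ is one-dimensional at every point. Let $(F,\omega_0)$ be a compact symplectic manifold, let $B$ be a compact manifold with a presymplectic form $\omega_B$, and let $p : M \to B$ be a symplectic fibration with fibre $(F,\omega_0)$, i.e. a smooth fibre bundle equipped with an atlas of smooth local trivializations $p^{-1}(U) \cong U \times F$ whose transition maps over each point of the base are symplectomorphisms of $(F,\omega_0)$. For $b \in B$ let $i_b : F_b = p^{-1}(b) \to M$ be the inclusion of the fibre and let $\omega_b$ be the symplectic form on $F_b$ that corresponds to $\omega_0$ under the local trivializations. \textbf{Theorem.} For every class $u \in H^2(M;\mathbb{R})$ such that $i_b^* u = [\omega_b]$ in $H^2(F_b;\mathbb{R})$ for all $b \in B$, there exist a real number $K > 0$ and a presymplectic form $\omega$ on $M$ such that $i_b^*\omega = \omega_b$ for all $b \in B$ and $[\omega] = u + K\,p^*[\omega_B]$. -/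

import Mathlib

open Set
open scoped Manifold ContDiff Topology

namespace DiffForm

section Forms

variable (E : Type*) [NormedAddCommGroup E] [NormedSpace ℝ E]
variable (M : Type*) [TopologicalSpace M] [ChartedSpace E M]

/-- A field of alternating `k`-linear forms on the tangent spaces of a boundaryless manifold `M`
modelled on `E` (no regularity in the base point is required yet). -/
def FormField (k : ℕ) : Type _ :=
  ∀ x : M, TangentSpace 𝓘(ℝ, E) x [⋀^Fin k]→L[ℝ] ℝ

noncomputable instance (k : ℕ) : AddCommGroup (FormField E M k) :=
  inferInstanceAs (AddCommGroup (∀ x : M, TangentSpace 𝓘(ℝ, E) x [⋀^Fin k]→L[ℝ] ℝ))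

noncomputable instance (k : ℕ) : Module ℝ (FormField E M k) :=
  inferInstanceAs (Module ℝ (∀ x : M, TangentSpace 𝓘(ℝ, E) x [⋀^Fin k]→L[ℝ] ℝ))

variable {E M}

/-- The coordinate expression of `σ` in the chart `c`, i.e. its pullback under `c⁻¹`;
it is meaningful on `c.target`. -/
noncomputable def localRep {k : ℕ} (σ : FormField E M k) (c : OpenPartialHomeomorph M E) :
    E → E [⋀^Fin k]→L[ℝ] ℝ :=
  fun y => (σ (c.symm y)).compContinuousLinearMap (mfderiv 𝓘(ℝ, E) 𝓘(ℝ, E) c.symm y)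

/-- `σ` is a smooth differential `k`-form: its coordinate expressions are smooth. -/
def IsSmooth {k : ℕ} (σ : FormField E M k) : Prop :=
  ∀ x₀ : M, ContDiffOn ℝ ∞ (localRep σ (chartAt E x₀)) (chartAt E x₀).target

/-- The exterior derivative, computed at each point in a chart around that point. -/
noncomputable def extD {k : ℕ} (σ : FormField E M k) : FormField E M (k + 1) :=
  fun x => (extDeriv (localRep σ (chartAt E x)) (chartAt E x x)).compContinuousLinearMap
    (mfderiv 𝓘(ℝ, E) 𝓘(ℝ, E) (chartAt E x) x)

variable {E' : Type*} [NormedAddCommGroup E'] [NormedSpace ℝ E']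
variable {N : Type*} [TopologicalSpace N] [ChartedSpace E' N]

/-- The pullback `f^* σ`. -/
noncomputable def pullback {k : ℕ} (f : N → M) (σ : FormField E M k) : FormField E' N k :=
  fun x => (σ (f x)).compContinuousLinearMap (mfderiv 𝓘(ℝ, E') 𝓘(ℝ, E) f x)

/-! ### Linearity -/

theorem localRep_add {k : ℕ} (σ η : FormField E M k) (c : OpenPartialHomeomorph M E) :
    localRep (σ + η) c = localRep σ c + localRep η c := rfl

theorem localRep_smul {k : ℕ} (a : ℝ) (σ : FormField E M k) (c : OpenPartialHomeomorph M E) :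
    localRep (a • σ) c = a • localRep σ c := rfl

theorem localRep_zero {k : ℕ} (c : OpenPartialHomeomorph M E) :
    localRep (0 : FormField E M k) c = 0 := rfl

theorem isSmooth_zero {k : ℕ} : IsSmooth (0 : FormField E M k) := fun x₀ => by
  rw [localRep_zero]
  exact contDiffOn_const

theorem IsSmooth.add {k : ℕ} {σ η : FormField E M k} (hσ : IsSmooth σ) (hη : IsSmooth η) :
    IsSmooth (σ + η) := fun x₀ => by
  rw [localRep_add]
  exact (hσ x₀).add (hη x₀)

theorem IsSmooth.smul {k : ℕ} {σ : FormField E M k} (a : ℝ) (hσ : IsSmooth σ) :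
    IsSmooth (a • σ) := fun x₀ => by
  rw [localRep_smul]
  exact contDiffOn_const.smul (hσ x₀)

theorem IsSmooth.contDiffAt {k : ℕ} {σ : FormField E M k} (hσ : IsSmooth σ) (x₀ : M) {y : E}
    (hy : y ∈ (chartAt E x₀).target) : ContDiffAt ℝ ∞ (localRep σ (chartAt E x₀)) y :=
  (hσ x₀).contDiffAt ((chartAt E x₀).open_target.mem_nhds hy)

theorem IsSmooth.differentiableAt {k : ℕ} {σ : FormField E M k} (hσ : IsSmooth σ) (x : M) :
    DifferentiableAt ℝ (localRep σ (chartAt E x)) (chartAt E x x) :=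
  (hσ.contDiffAt x (mem_chart_target E x)).differentiableAt (by simp)

theorem extD_zero {k : ℕ} : extD (0 : FormField E M k) = 0 := by
  funext x
  have h : extDeriv (0 : E → E [⋀^Fin k]→L[ℝ] ℝ) (chartAt E x x) = 0 := by
    have h0 : fderiv ℝ (0 : E → E [⋀^Fin k]→L[ℝ] ℝ) (chartAt E x x) = 0 := by
      rw [fderiv_zero]; rfl
    rw [extDeriv, h0]
    exact map_zero (ContinuousAlternatingMap.alternatizeUncurryFinCLM ℝ E ℝ)
  rw [extD, localRep_zero, h]
  rfl

theorem extD_add {k : ℕ} {σ η : FormField E M k} (hσ : IsSmooth σ) (hη : IsSmooth η) :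
    extD (σ + η) = extD σ + extD η := by
  funext x
  rw [extD, localRep_add, extDeriv_add (hσ.differentiableAt x) (hη.differentiableAt x)]
  rfl

theorem extD_smul {k : ℕ} (a : ℝ) (σ : FormField E M k) : extD (a • σ) = a • extD σ := by
  funext x
  rw [extD, localRep_smul]
  have h : extDeriv (a • localRep σ (chartAt E x)) (chartAt E x x)
      = a • extDeriv (localRep σ (chartAt E x)) (chartAt E x x) := extDeriv_fun_smul a _
  rw [h]
  rfl

/-- Smooth closed `k`-forms. -/
noncomputable def closedForms (E : Type*) [NormedAddCommGroup E] [NormedSpace ℝ E]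
    (M : Type*) [TopologicalSpace M] [ChartedSpace E M] (k : ℕ) :
    Submodule ℝ (FormField E M k) where
  carrier := {σ | IsSmooth σ ∧ extD σ = 0}
  zero_mem' := ⟨isSmooth_zero, extD_zero⟩
  add_mem' := fun {σ η} hσ hη => ⟨hσ.1.add hη.1, by rw [extD_add hσ.1 hη.1, hσ.2, hη.2, add_zero]⟩
  smul_mem' := fun a σ hσ => ⟨hσ.1.smul a, by rw [extD_smul, hσ.2, smul_zero]⟩

/-- Exact `k`-forms, i.e. differentials of smooth `(k - 1)`-forms (only `0` if `k = 0`). -/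
noncomputable def exactForms (E : Type*) [NormedAddCommGroup E] [NormedSpace ℝ E]
    (M : Type*) [TopologicalSpace M] [ChartedSpace E M] :
    (k : ℕ) → Submodule ℝ (FormField E M k)
  | 0 => ⊥
  | _ + 1 =>
    { carrier := {σ | ∃ α, IsSmooth α ∧ extD α = σ}
      zero_mem' := ⟨0, isSmooth_zero, extD_zero⟩
      add_mem' := by
        rintro _ _ ⟨α, hα, rfl⟩ ⟨β, hβ, rfl⟩
        exact ⟨α + β, hα.add hβ, extD_add hα hβ⟩
      smul_mem' := by
        rintro a _ ⟨α, hα, rfl⟩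
        exact ⟨a • α, hα.smul a, extD_smul a α⟩ }

/-- De Rham cohomology `H^k(M; ℝ)`: closed forms modulo exact forms. -/
abbrev DeRham (E : Type*) [NormedAddCommGroup E] [NormedSpace ℝ E]
    (M : Type*) [TopologicalSpace M] [ChartedSpace E M] (k : ℕ) : Type _ :=
  closedForms E M k ⧸ (exactForms E M k).submoduleOf (closedForms E M k)

/-- The cohomology class `[σ]` of a closed form. -/
noncomputable def cohomClass {k : ℕ} (σ : closedForms E M k) : DeRham E M k :=
  Submodule.Quotient.mk σ

/-! ### Functoriality -/

theorem contDiff_compContinuousLinearMap {G G' : Type*} [NormedAddCommGroup G] [NormedSpace ℝ G]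
    [NormedAddCommGroup G'] [NormedSpace ℝ G'] {k : ℕ} :
    ContDiff ℝ ∞ (fun q : (G [⋀^Fin k]→L[ℝ] ℝ) × (G' →L[ℝ] G) =>
      q.1.compContinuousLinearMap q.2) := by
  classical
  -- recover an alternating map from its underlying multilinear map by averaging
  let A : ContinuousMultilinearMap ℝ (fun _ : Fin k => G') ℝ →ₗ[ℝ] (G' [⋀^Fin k]→L[ℝ] ℝ) :=
    { toFun := fun f => ContinuousMultilinearMap.alternatization f
      map_add' := fun f g => map_add _ f g
      map_smul' := fun a f => by
        ext v
        simp [ContinuousMultilinearMap.alternatization_apply_apply, Finset.mul_sum, mul_smul_comm] }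
  have hA : Continuous A := by
    refine (A.mkContinuous (k.factorial : ℝ) fun f => ?_).continuous
    refine ContinuousAlternatingMap.opNorm_le_bound _ (by positivity) fun v => ?_
    change ‖ContinuousMultilinearMap.alternatization f v‖ ≤ _
    rw [ContinuousMultilinearMap.alternatization_apply_apply]
    calc ‖∑ τ : Equiv.Perm (Fin k), Equiv.Perm.sign τ • f (v ∘ τ)‖
        ≤ ∑ τ : Equiv.Perm (Fin k), ‖f‖ * ∏ i, ‖v i‖ := by
          refine norm_sum_le_of_le _ fun τ _ => ?_
          have h1 : ‖Equiv.Perm.sign τ • f (v ∘ τ)‖ = ‖f (v ∘ τ)‖ := by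
            rcases Int.units_eq_one_or (Equiv.Perm.sign τ) with h | h <;> simp [h]
          rw [h1]
          refine (f.le_opNorm _).trans (le_of_eq ?_)
          congr 1
          exact Equiv.prod_comp τ (fun i => ‖v i‖)
      _ = k.factorial * ‖f‖ * ∏ i, ‖v i‖ := by
          simp [Finset.card_univ, Fintype.card_perm, mul_assoc]
  have h1 : ContDiff ℝ ∞ (fun q : (G [⋀^Fin k]→L[ℝ] ℝ) × (G' →L[ℝ] G) =>
      q.1.toContinuousMultilinearMap.compContinuousLinearMap (fun _ => q.2)) := by
    have h2 : ContDiff ℝ ∞ (fun q : (Fin k → G' →L[ℝ] G) ×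
        ContinuousMultilinearMap ℝ (fun _ : Fin k => G) ℝ => q.2.compContinuousLinearMap q.1) :=
      contDiff_iff_contDiffAt.2 fun q =>
        ContinuousMultilinearMap.analyticAt_uncurry_compContinuousLinearMap.contDiffAt
    refine h2.comp (ContDiff.prodMk (contDiff_pi.2 fun _ => contDiff_snd) ?_)
    have h0 := (ContinuousAlternatingMap.toContinuousMultilinearMapLI (𝕜 := ℝ) (E := G) (F := ℝ)
      (ι := Fin k)).toContinuousLinearMap.contDiff (n := ∞)
    exact h0.comp contDiff_fst
  have h3 : (fun q : (G [⋀^Fin k]→L[ℝ] ℝ) × (G' →L[ℝ] G) => q.1.compContinuousLinearMap q.2) =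
      fun q => ((k.factorial : ℝ)⁻¹) • (⟨A, hA⟩ : _ →L[ℝ] _)
        (q.1.toContinuousMultilinearMap.compContinuousLinearMap (fun _ => q.2)) := by
    funext q
    ext v
    change q.1 (q.2 ∘ v) = (k.factorial : ℝ)⁻¹ • ContinuousMultilinearMap.alternatization
      (q.1.toContinuousMultilinearMap.compContinuousLinearMap (fun _ => q.2)) v
    rw [ContinuousMultilinearMap.alternatization_apply_apply]
    have h5 : ∀ τ : Equiv.Perm (Fin k), Equiv.Perm.sign τ •
        (q.1.toContinuousMultilinearMap.compContinuousLinearMap (fun _ => q.2)) (v ∘ τ) =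
        q.1 (q.2 ∘ v) := by
      intro τ
      have h6 : (q.1.toContinuousMultilinearMap.compContinuousLinearMap (fun _ => q.2)) (v ∘ τ) =
          Equiv.Perm.sign τ • q.1 (q.2 ∘ v) := q.1.toAlternatingMap.map_perm (q.2 ∘ v) τ
      rw [h6, smul_smul, Int.units_mul_self, one_smul]
    simp only [h5]
    have h7 : (k.factorial : ℝ) ≠ 0 := by positivity
    simp [Finset.card_univ, Fintype.card_perm, h7]
  rw [h3]
  have h4 := (⟨A, hA⟩ : ContinuousMultilinearMap ℝ (fun _ : Fin k => G') ℝ →L[ℝ]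
    (G' [⋀^Fin k]→L[ℝ] ℝ)).contDiff (n := ∞)
  exact (h4.comp h1).const_smul ((k.factorial : ℝ)⁻¹)

theorem pullback_add {k : ℕ} (f : N → M) (σ η : FormField E M k) :
    (pullback f (σ + η) : FormField E' N k) = pullback f σ + pullback f η := rfl

theorem pullback_smul {k : ℕ} (f : N → M) (a : ℝ) (σ : FormField E M k) :
    (pullback f (a • σ) : FormField E' N k) = a • pullback f σ := rfl

section Smooth

variable [IsManifold 𝓘(ℝ, E) ∞ M] [IsManifold 𝓘(ℝ, E') ∞ N]

/-- The coordinate expression of `f` in the charts around `x₀` and `z`. -/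
theorem contDiffAt_coord {f : N → M} (hf : ContMDiff 𝓘(ℝ, E') 𝓘(ℝ, E) ∞ f) (x₀ : N) (z : M)
    {y : E'} (hy : y ∈ (chartAt E' x₀).target)
    (hz : f ((chartAt E' x₀).symm y) ∈ (chartAt E z).source) :
    ContDiffAt ℝ ∞ (fun y => chartAt E z (f ((chartAt E' x₀).symm y))) y := by
  rw [← contMDiffAt_iff_contDiffAt]
  have h1 : ContMDiffAt 𝓘(ℝ, E') 𝓘(ℝ, E') ∞ (chartAt E' x₀).symm y :=
    contMDiffAt_symm_of_mem_maximalAtlas (IsManifold.chart_mem_maximalAtlas x₀) hy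
  have h2 : ContMDiffAt 𝓘(ℝ, E) 𝓘(ℝ, E) ∞ (chartAt E z) (f ((chartAt E' x₀).symm y)) :=
    contMDiffAt_of_mem_maximalAtlas (IsManifold.chart_mem_maximalAtlas z) hz
  exact h2.comp y ((hf _).comp y h1)

theorem localRep_pullback {k : ℕ} {f : N → M} (hf : ContMDiff 𝓘(ℝ, E') 𝓘(ℝ, E) ∞ f)
    (σ : FormField E M k) (x₀ : N) (z : M)
    {y : E'} (hy : y ∈ (chartAt E' x₀).target)
    (hz : f ((chartAt E' x₀).symm y) ∈ (chartAt E z).source) :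
    localRep (pullback f σ : FormField E' N k) (chartAt E' x₀) =ᶠ[𝓝 y]
      fun y => (localRep σ (chartAt E z)
          (chartAt E z (f ((chartAt E' x₀).symm y)))).compContinuousLinearMap
        (fderiv ℝ (fun y => chartAt E z (f ((chartAt E' x₀).symm y))) y) := by
  have hc : ContinuousAt (fun y => f ((chartAt E' x₀).symm y)) y :=
    hf.continuous.continuousAt.comp ((chartAt E' x₀).symm.continuousAt hy)
  have hev : ∀ᶠ y' in 𝓝 y, y' ∈ (chartAt E' x₀).target ∧
      f ((chartAt E' x₀).symm y') ∈ (chartAt E z).source :=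
    Filter.Eventually.and ((chartAt E' x₀).open_target.mem_nhds hy)
      (hc.preimage_mem_nhds ((chartAt E z).open_source.mem_nhds hz))
  filter_upwards [hev.eventually_nhds] with y' hy'
  obtain ⟨hy1, hy2⟩ := hy'.self_of_nhds
  have hg := contDiffAt_coord hf x₀ z hy1 hy2
  set g := fun y => chartAt E z (f ((chartAt E' x₀).symm y)) with hgdef
  have h1 : MDifferentiableAt 𝓘(ℝ, E') 𝓘(ℝ, E') (chartAt E' x₀).symm y' :=
    mdifferentiableAt_atlas_symm (chart_mem_atlas E' x₀) hy1
  have h2 : MDifferentiableAt 𝓘(ℝ, E') 𝓘(ℝ, E) f ((chartAt E' x₀).symm y') :=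
    (hf _).mdifferentiableAt (by simp)
  have h3 : MDifferentiableAt 𝓘(ℝ, E') 𝓘(ℝ, E) g y' :=
    (hg.differentiableAt (by simp)).mdifferentiableAt
  have h4 : MDifferentiableAt 𝓘(ℝ, E) 𝓘(ℝ, E) (chartAt E z).symm (g y') :=
    mdifferentiableAt_atlas_symm (chart_mem_atlas E z) ((chartAt E z).map_source hy2)
  have key : mfderiv 𝓘(ℝ, E') 𝓘(ℝ, E) (f ∘ (chartAt E' x₀).symm) y' =
      mfderiv 𝓘(ℝ, E') 𝓘(ℝ, E) ((chartAt E z).symm ∘ g) y' := by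
    apply Filter.EventuallyEq.mfderiv_eq
    filter_upwards [hy'] with t ht
    exact ((chartAt E z).left_inv ht.2).symm
  rw [mfderiv_comp y' h2 h1, mfderiv_comp y' h4 h3, mfderiv_eq_fderiv] at key
  have hpt : (chartAt E z).symm (g y') = f ((chartAt E' x₀).symm y') := (chartAt E z).left_inv hy2
  have hσ : ∀ a b : M, a = b → ∀ v : Fin k → E, σ a v = σ b v := by
    rintro a _ rfl v; rfl
  ext v
  have key' : ∀ w : E', mfderiv 𝓘(ℝ, E') 𝓘(ℝ, E) f ((chartAt E' x₀).symm y')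
      (mfderiv 𝓘(ℝ, E') 𝓘(ℝ, E') (chartAt E' x₀).symm y' w) =
      mfderiv 𝓘(ℝ, E) 𝓘(ℝ, E) (chartAt E z).symm (g y') (fderiv ℝ g y' w) :=
    fun w => DFunLike.congr_fun key w
  refine (hσ _ _ hpt.symm _).trans ?_
  exact congrArg (σ ((chartAt E z).symm (g y'))) (funext fun i => key' (v i))

theorem IsSmooth.pullback {k : ℕ} {f : N → M} (hf : ContMDiff 𝓘(ℝ, E') 𝓘(ℝ, E) ∞ f)
    {σ : FormField E M k} (hσ : IsSmooth σ) :
    IsSmooth (DiffForm.pullback f σ : FormField E' N k) := by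
  intro x₀ y hy
  set z := f ((chartAt E' x₀).symm y)
  have hz : z ∈ (chartAt E z).source := mem_chart_source E z
  have hg := contDiffAt_coord hf x₀ z hy hz
  refine ContDiffAt.contDiffWithinAt ?_
  refine ContDiffAt.congr_of_eventuallyEq ?_ (localRep_pullback hf σ x₀ z hy hz)
  refine contDiff_compContinuousLinearMap.contDiffAt.comp y (ContDiffAt.prodMk ?_ ?_)
  · exact (hσ.contDiffAt z (mem_chart_target E z)).comp y hg
  · exact hg.fderiv_right (by simp)

theorem extD_pullback {k : ℕ} {f : N → M} (hf : ContMDiff 𝓘(ℝ, E') 𝓘(ℝ, E) ∞ f)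
    {σ : FormField E M k} (hσ : IsSmooth σ) :
    extD (pullback f σ : FormField E' N k) = pullback f (extD σ) := by
  funext x
  set z := f x
  have hx : (chartAt E' x).symm (chartAt E' x x) = x :=
    (chartAt E' x).left_inv (mem_chart_source E' x)
  have hz : f ((chartAt E' x).symm (chartAt E' x x)) ∈ (chartAt E z).source := by
    rw [hx]; exact mem_chart_source E z
  have hg := contDiffAt_coord hf x z (mem_chart_target E' x) hz
  have hL := localRep_pullback hf σ x z (mem_chart_target E' x) hz
  set g := fun y => chartAt E z (f ((chartAt E' x).symm y)) with hgdef
  have hgx : g (chartAt E' x x) = chartAt E z z := by simp only [hgdef, hx]; rfl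
  have hd : extDeriv (localRep (pullback f σ : FormField E' N k) (chartAt E' x)) (chartAt E' x x) =
      (extDeriv (localRep σ (chartAt E z)) (g (chartAt E' x x))).compContinuousLinearMap
        (fderiv ℝ g (chartAt E' x x)) := by
    rw [hL.extDeriv_eq]
    have hdg : DifferentiableAt ℝ (localRep σ (chartAt E z)) (g (chartAt E' x x)) := by
      rw [hgx]; exact hσ.differentiableAt z
    have hr2 : minSmoothness ℝ 2 ≤ (∞ : WithTop ℕ∞) := by
      rw [minSmoothness_of_isRCLikeNormedField]
      exact WithTop.coe_le_coe.2 (le_top : (2 : ℕ∞) ≤ ⊤)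
    exact extDeriv_pullback (r := ∞) hdg hg hr2
  have h1 : MDifferentiableAt 𝓘(ℝ, E') 𝓘(ℝ, E') (chartAt E' x) x :=
    mdifferentiableAt_atlas (chart_mem_atlas E' x) (mem_chart_source E' x)
  have h2 : MDifferentiableAt 𝓘(ℝ, E') 𝓘(ℝ, E) f x := (hf x).mdifferentiableAt (by simp)
  have h3 : MDifferentiableAt 𝓘(ℝ, E') 𝓘(ℝ, E) g (chartAt E' x x) :=
    (hg.differentiableAt (by simp)).mdifferentiableAt
  have h4 : MDifferentiableAt 𝓘(ℝ, E) 𝓘(ℝ, E) (chartAt E z) (f x) :=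
    mdifferentiableAt_atlas (chart_mem_atlas E z) (mem_chart_source E z)
  have key : mfderiv 𝓘(ℝ, E') 𝓘(ℝ, E) (g ∘ chartAt E' x) x =
      mfderiv 𝓘(ℝ, E') 𝓘(ℝ, E) (chartAt E z ∘ f) x := by
    apply Filter.EventuallyEq.mfderiv_eq
    filter_upwards [(chartAt E' x).open_source.mem_nhds (mem_chart_source E' x)] with t ht
    simp only [hgdef, Function.comp, (chartAt E' x).left_inv ht]
  rw [mfderiv_comp x h3 h1, mfderiv_comp x h4 h2, mfderiv_eq_fderiv] at key
  ext v
  have key' : ∀ w : E', fderiv ℝ g (chartAt E' x x) (mfderiv 𝓘(ℝ, E') 𝓘(ℝ, E') (chartAt E' x) x w) =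
      mfderiv 𝓘(ℝ, E) 𝓘(ℝ, E) (chartAt E z) (f x) (mfderiv 𝓘(ℝ, E') 𝓘(ℝ, E) f x w) :=
    fun w => DFunLike.congr_fun key w
  change extDeriv (localRep (pullback f σ : FormField E' N k) (chartAt E' x)) (chartAt E' x x)
      (fun i => mfderiv 𝓘(ℝ, E') 𝓘(ℝ, E') (chartAt E' x) x (v i)) =
    extDeriv (localRep σ (chartAt E z)) (chartAt E z z)
      (fun i => mfderiv 𝓘(ℝ, E) 𝓘(ℝ, E) (chartAt E z) (f x) (mfderiv 𝓘(ℝ, E') 𝓘(ℝ, E) f x (v i)))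
  rw [hd, hgx]
  exact congrArg (extDeriv (localRep σ (chartAt E z)) (chartAt E z z))
    (funext fun i => key' (v i))

/-- The map `f^* : H^k(M) → H^k(N)` induced by a smooth map `f : N → M`. -/
noncomputable def cohomPullback {k : ℕ} (f : C^∞⟮𝓘(ℝ, E'), N; 𝓘(ℝ, E), M⟯) :
    DeRham E M k →ₗ[ℝ] DeRham E' N k :=
  Submodule.mapQ _ _
    (LinearMap.restrict
      ({ toFun := pullback f
         map_add' := pullback_add f
         map_smul' := pullback_smul f } : FormField E M k →ₗ[ℝ] FormField E' N k)
      (p := closedForms E M k) (q := closedForms E' N k)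
      (fun σ hσ => ⟨hσ.1.pullback f.contMDiff, by
        change extD (pullback f σ) = 0
        rw [extD_pullback f.contMDiff hσ.1, hσ.2]; rfl⟩))
    (by
      rintro ⟨σ, hσ⟩ h
      cases k with
      | zero =>
        have h0 : σ = 0 := h
        subst h0
        exact Submodule.zero_mem _
      | succ k =>
        obtain ⟨α, hα, hασ⟩ : ∃ α : FormField E M k, IsSmooth α ∧ extD α = σ := h
        exact ⟨pullback f α, hα.pullback f.contMDiff, by
          rw [extD_pullback f.contMDiff hα, hασ]; rfl⟩)

end Smooth

/-! ### Symplectic and presymplectic forms -/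

/-- The kernel `{v | ι_v σ = 0}` of a 2-form at the point `x`. -/
noncomputable def kernelAt (σ : FormField E M 2) (x : M) : Submodule ℝ (TangentSpace 𝓘(ℝ, E) x) where
  carrier := {v | ∀ w : TangentSpace 𝓘(ℝ, E) x, σ x ![v, w] = 0}
  zero_mem' := fun w => (σ x).map_coord_zero 0 rfl
  add_mem' := fun {v v'} hv hv' w => by rw [(σ x).vecCons_add, hv w, hv' w, add_zero]
  smul_mem' := fun a v hv w => by rw [(σ x).vecCons_smul, hv w, smul_zero]

/-- A symplectic form: a smooth closed non-degenerate 2-form. -/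
def IsSymplectic (σ : FormField E M 2) : Prop :=
  σ ∈ closedForms E M 2 ∧ ∀ x, kernelAt σ x = ⊥

/-- A presymplectic form: a smooth closed 2-form of maximal rank on an odd-dimensional manifold,
i.e. of rank `2n` in dimension `2n + 1`, so that its kernel is a line at every point. -/
def IsPresymplectic (σ : FormField E M 2) : Prop :=
  σ ∈ closedForms E M 2 ∧ Odd (Module.finrank ℝ E) ∧
    ∀ x, Module.finrank ℝ (kernelAt σ x) = 1

end Forms

/-! ### Symplectic fibrations -/

variable {EM : Type*} [NormedAddCommGroup EM] [NormedSpace ℝ EM]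
variable {EB : Type*} [NormedAddCommGroup EB] [NormedSpace ℝ EB]
variable {EF : Type*} [NormedAddCommGroup EF] [NormedSpace ℝ EF]
variable {M : Type*} [TopologicalSpace M] [ChartedSpace EM M]
variable {B : Type*} [TopologicalSpace B] [ChartedSpace EB B]
variable {F : Type*} [TopologicalSpace F] [ChartedSpace EF F]

/-- The structure of a symplectic fibration on `p : M → B` with fibre `(F, ω₀)`: a bundle atlas of
local trivializations `e : p⁻¹(U) → U × F` (with `U = e.baseSet`) that are diffeomorphisms and
whose transition maps on the fibres preserve `ω₀`, so that the structure group is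
`Symp(F, ω₀)`. -/
structure SymplecticFibration (EM EB : Type*) {EF : Type*}
    [NormedAddCommGroup EM] [NormedSpace ℝ EM] [NormedAddCommGroup EB] [NormedSpace ℝ EB]
    [NormedAddCommGroup EF] [NormedSpace ℝ EF]
    {M B F : Type*} [TopologicalSpace M] [ChartedSpace EM M]
    [TopologicalSpace B] [ChartedSpace EB B] [TopologicalSpace F] [ChartedSpace EF F]
    (p : M → B) (ω₀ : FormField EF F 2) where
  /-- the local trivializations -/
  atlas : Set (Bundle.Trivialization F p)
  cover : ∀ b : B, ∃ e ∈ atlas, b ∈ e.baseSet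
  smooth : ∀ e ∈ atlas,
    ContMDiffOn 𝓘(ℝ, EM) (𝓘(ℝ, EB).prod 𝓘(ℝ, EF)) ∞ e e.source
  smooth_symm : ∀ e ∈ atlas,
    ContMDiffOn (𝓘(ℝ, EB).prod 𝓘(ℝ, EF)) 𝓘(ℝ, EM) ∞ e.toOpenPartialHomeomorph.symm e.target
  symplectic : ∀ e ∈ atlas, ∀ e' ∈ atlas, ∀ b ∈ e.baseSet ∩ e'.baseSet,
    pullback (e.coordChange e' b) ω₀ = ω₀

/-- The inclusion `i_b : F_b → M` of the fibre over `b`, where `F_b` is identified with `F` by the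
local trivialization `e`. Under this identification the form `ω_b` on `F_b` is `ω₀`, and this does
not depend on `e` because the transition maps preserve `ω₀`. -/
noncomputable def SymplecticFibration.fibreIncl {p : M → B} {ω₀ : FormField EF F 2}
    (P : SymplecticFibration EM EB p ω₀) {e : Bundle.Trivialization F p} (he : e ∈ P.atlas)
    {b : B} (hb : b ∈ e.baseSet) : C^∞⟮𝓘(ℝ, EF), F; 𝓘(ℝ, EM), M⟯ :=
  ⟨fun y => e.toOpenPartialHomeomorph.symm (b, y), fun y =>
    ((P.smooth_symm e he).contMDiffAt
      (e.open_target.mem_nhds (e.mem_target.2 hb))).comp y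
      (contMDiffAt_const.prodMk contMDiffAt_id)⟩

end DiffForm

/-! The argument is Thurston's construction in two stages: a representative of `u` is corrected by
an exact form until it restricts to the given form on every fibre, and then a large multiple of the
pullback of the base form removes all unwanted degeneracy.

Stage one. Let `σ₀` be a closed form representing `u`. On each single fibre `σ₀ - ω₀` has a
primitive, but primitives chosen separately need not vary smoothly with the fibre. Near `b₀` only
one of them, `α` on the fibre over `b₀`, is used. The rest comes from the homotopy operator that
contracts `EB × F` onto `{0} × F`, since its fibrewise differential is the difference between the
restrictions of `σ₀` to the fibre at hand and to the fibre over `b₀` (`pullback_extD_vertHomotopy`).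
Adding the pullback of `α` gives a smooth local 1-form that is a primitive on all nearby fibres
(`SymplecticFibration.exists_local_primitive`). Such forms are glued by a partition of unity on the
base: the cut-offs are constant along fibres, so no `dρ` term survives restriction
(`SymplecticFibration.exists_primitive_correction`). The outcome is `τ = σ₀ - dμ`, in the class `u`
and with the right fibre restrictions.

Stage two. Put `K = ε⁻²`. Rescaling base directions by `ε` turns `τ + ε⁻² p^*ωB` into `ωB + τ(S_ε ·,
S_ε ·)`, where `S_ε` is `dilateFst`. This family extends continuously to `ε = 0`, where it is the
block sum of `ωB` and `ω₀` and so has a one-dimensional kernel. The condition "kernel of dimension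
at most one", witnessed by a functional that is injective on the kernel, is open
(`eventually_dilate_nondegenerate`), and compactness of `F` and `B` makes one `ε` work everywhere
(`SymplecticFibration.exists_pos_finrank_kernelAt_le_one`). Since `dim M = dim B + dim F` is odd,
the kernel is never zero, hence a line. -/

/-! ### Smoothness of integrals over `[0, 1]` depending on a parameter. -/

section ParametricIntegral

open MeasureTheory Filter

variable {H G : Type*} [NormedAddCommGroup H] [NormedSpace ℝ H]
  [NormedAddCommGroup G] [NormedSpace ℝ G]

/-- Dominated differentiation; the dominating function is a constant, available because `[0, 1]` is
compact. -/
theorem hasFDerivAt_parametric_intervalIntegral [CompleteSpace G] {O : Set H} (hO : IsOpen O)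
    {f : H × ℝ → G} (hf : ContDiffOn ℝ 1 f (O ×ˢ univ)) {q : H} (hq : q ∈ O) :
    HasFDerivAt (fun q => ∫ t in (0 : ℝ)..1, f (q, t))
      (∫ t in (0 : ℝ)..1, (fderiv ℝ f (q, t)).comp (ContinuousLinearMap.inl ℝ H ℝ)) q := by
  have hO' : IsOpen (O ×ˢ (univ : Set ℝ)) := hO.prod isOpen_univ
  have hfd : ContinuousOn (fun x => (fderiv ℝ f x).comp (ContinuousLinearMap.inl ℝ H ℝ))
      (O ×ˢ univ) :=
    (hf.continuousOn_fderiv_of_isOpen hO' le_rfl).clm_comp continuousOn_const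
  have hslice : ∀ x ∈ O, Continuous fun t => f (x, t) := fun x hx =>
    hf.continuousOn.comp_continuous (by fun_prop) fun t => ⟨hx, mem_univ t⟩
  have hslice' : ∀ x ∈ O, Continuous fun t =>
      (fderiv ℝ f (x, t)).comp (ContinuousLinearMap.inl ℝ H ℝ) := fun x hx =>
    hfd.comp_continuous (by fun_prop) fun t => ⟨hx, mem_univ t⟩
  obtain ⟨C, hC⟩ : ∃ C, ∀ t ∈ Icc (0 : ℝ) 1,
      ‖(fderiv ℝ f (q, t)).comp (ContinuousLinearMap.inl ℝ H ℝ)‖ ≤ C :=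
    isCompact_Icc.exists_bound_of_continuousOn (hslice' q hq).continuousOn
  -- Tube lemma: the bound `C` on the slice over `q` persists as `C + 1` on nearby slices, uniformly
  -- in `t`.
  have hnear : ∀ᶠ x in 𝓝 q, ∀ t ∈ Icc (0 : ℝ) 1, x ∈ O ∧
      ‖(fderiv ℝ f (x, t)).comp (ContinuousLinearMap.inl ℝ H ℝ)‖ ≤ C + 1 := by
    refine isCompact_Icc.eventually_forall_of_forall_eventually fun t ht => ?_
    have h1 : ContinuousAt (fun x => ‖(fderiv ℝ f x).comp (ContinuousLinearMap.inl ℝ H ℝ)‖)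
        (q, t) := (hfd.continuousAt (hO'.mem_nhds ⟨hq, mem_univ t⟩)).norm
    filter_upwards [h1.eventually (gt_mem_nhds ((hC t ht).trans_lt (lt_add_one C))),
      hO'.mem_nhds ⟨hq, mem_univ t⟩] with x hx hx'
    exact ⟨hx'.1, hx.le⟩
  refine intervalIntegral.hasFDerivAt_integral_of_dominated_of_fderiv_le (𝕜 := ℝ)
    (F := fun x t => f (x, t))
    (F' := fun x t => (fderiv ℝ f (x, t)).comp (ContinuousLinearMap.inl ℝ H ℝ))
    (bound := fun _ => C + 1) hnear ?_ ?_ ?_ ?_ ?_ ?_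
  · filter_upwards [hO.mem_nhds hq] with x hx
    exact (hslice x hx).aestronglyMeasurable
  · exact (hslice q hq).intervalIntegrable _ _
  · exact (hslice' q hq).aestronglyMeasurable
  · refine Eventually.of_forall fun t ht x hx => (hx t ?_).2
    rw [uIoc_of_le zero_le_one] at ht
    exact Ioc_subset_Icc_self ht
  · exact intervalIntegrable_const
  · refine Eventually.of_forall fun t ht x hx => ?_
    rw [uIoc_of_le zero_le_one] at ht
    have h2 : HasFDerivAt f (fderiv ℝ f (x, t)) (x, t) :=
      ((hf.contDiffAt (hO'.mem_nhds ⟨(hx t (Ioc_subset_Icc_self ht)).1,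
        mem_univ t⟩)).differentiableAt (by simp)).hasFDerivAt
    exact h2.comp x (hasFDerivAt_prodMk_left x t)

theorem fderiv_parametric_intervalIntegral_apply [CompleteSpace G] {O : Set H} (hO : IsOpen O)
    {f : H × ℝ → G} (hf : ContDiffOn ℝ 1 f (O ×ˢ univ)) {q : H} (hq : q ∈ O) (v : H)
    (T : G →L[ℝ] ℝ) :
    T (fderiv ℝ (fun q => ∫ t in (0 : ℝ)..1, f (q, t)) q v) =
      ∫ t in (0 : ℝ)..1, T (fderiv ℝ f (q, t) (v, 0)) := by
  have hc : Continuous fun t : ℝ => (fderiv ℝ f (q, t)).comp (ContinuousLinearMap.inl ℝ H ℝ) :=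
    (((hf.continuousOn_fderiv_of_isOpen (hO.prod isOpen_univ) le_rfl).clm_comp
      continuousOn_const).comp_continuous (by fun_prop) fun t => ⟨hq, mem_univ t⟩)
  rw [(hasFDerivAt_parametric_intervalIntegral hO hf hq).fderiv]
  exact (ContinuousLinearMap.intervalIntegral_comp_comm
    (T.comp (ContinuousLinearMap.apply ℝ G v)) (hc.intervalIntegrable 0 1)).symm

end ParametricIntegral

section ParametricIntegralSmooth

universe u

variable {H : Type u} [NormedAddCommGroup H] [NormedSpace ℝ H]

/-- The derivative is an integral of the same kind with values in `H →L[ℝ] G`. The induction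
therefore quantifies over `G`, and the common universe of `H` and `G` keeps this space in range. -/
theorem contDiffOn_nat_parametric_intervalIntegral {O : Set H} (hO : IsOpen O) (n : ℕ) :
    ∀ {G : Type u} [NormedAddCommGroup G] [NormedSpace ℝ G] [CompleteSpace G] {f : H × ℝ → G},
      ContDiffOn ℝ ∞ f (O ×ˢ univ) →
      ContDiffOn ℝ n (fun q => ∫ t in (0 : ℝ)..1, f (q, t)) O := by
  induction n with
  | zero =>
    intro G _ _ _ f hf
    refine contDiffOn_zero.2 fun q hq => ?_
    exact (hasFDerivAt_parametric_intervalIntegral hO (hf.of_le (by simp))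
      hq).continuousAt.continuousWithinAt
  | succ n ih =>
    intro G _ _ _ f hf
    have h1 : ContDiffOn ℝ 1 f (O ×ˢ univ) := hf.of_le (by simp)
    push_cast
    refine (contDiffOn_succ_iff_fderiv_of_isOpen hO).2 ⟨fun q hq =>
      (hasFDerivAt_parametric_intervalIntegral hO h1 hq).differentiableAt.differentiableWithinAt,
      by simp, ?_⟩
    have h2 : ContDiffOn ℝ ∞ (fun x => (fderiv ℝ f x).comp (ContinuousLinearMap.inl ℝ H ℝ))
        (O ×ˢ univ) :=
      (hf.fderiv_of_isOpen (hO.prod isOpen_univ) (by simp)).clm_comp contDiffOn_const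
    exact (ih h2).congr fun q hq => (hasFDerivAt_parametric_intervalIntegral hO h1 hq).fderiv

theorem contDiffOn_parametric_intervalIntegral {O : Set H} (hO : IsOpen O)
    {G : Type u} [NormedAddCommGroup G] [NormedSpace ℝ G] [CompleteSpace G] {f : H × ℝ → G}
    (hf : ContDiffOn ℝ ∞ f (O ×ˢ univ)) :
    ContDiffOn ℝ ∞ (fun q => ∫ t in (0 : ℝ)..1, f (q, t)) O :=
  contDiffOn_infty.2 fun n => contDiffOn_nat_parametric_intervalIntegral hO n hf

end ParametricIntegralSmooth

theorem contDiff_curryLeft {E : Type*} [NormedAddCommGroup E] [NormedSpace ℝ E] :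
    ContDiff ℝ ∞ fun η : E [⋀^Fin 2]→L[ℝ] ℝ => (η.curryLeft : E →L[ℝ] E [⋀^Fin 1]→L[ℝ] ℝ) := by
  have h : IsBoundedLinearMap ℝ fun η : E [⋀^Fin 2]→L[ℝ] ℝ =>
      (η.curryLeft : E →L[ℝ] E [⋀^Fin 1]→L[ℝ] ℝ) :=
    ⟨⟨fun a b => a.curryLeft_add b, fun c a => a.curryLeft_smul c⟩, 1, one_pos,
      fun a => by rw [a.norm_curryLeft, one_mul]⟩
  exact h.contDiff

/-! ### The vertical homotopy operator in coordinates. -/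

section VerticalHomotopy

universe u v

variable {EB : Type u} [NormedAddCommGroup EB] [NormedSpace ℝ EB]
variable {EF : Type v} [NormedAddCommGroup EF] [NormedSpace ℝ EF]

/-- The 1-form `v ↦ η ((y, 0), (0, v.2))`. -/
noncomputable def vertContract (y : EB) (η : (EB × EF) [⋀^Fin 2]→L[ℝ] ℝ) :
    (EB × EF) [⋀^Fin 1]→L[ℝ] ℝ :=
  (η.curryLeft (y, 0)).compContinuousLinearMap
    ((ContinuousLinearMap.inr ℝ EB EF).comp (ContinuousLinearMap.snd ℝ EB EF))

theorem vertContract_apply (y : EB) (η : (EB × EF) [⋀^Fin 2]→L[ℝ] ℝ) (v : Fin 1 → EB × EF) :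
    vertContract y η v = η ![(y, 0), (0, (v 0).2)] := by
  rw [vertContract, ContinuousAlternatingMap.compContinuousLinearMap_apply,
    ContinuousAlternatingMap.curryLeft_apply_apply]
  congr 1
  ext i <;> fin_cases i <;> rfl

theorem contDiff_vertContract :
    ContDiff ℝ ∞ fun x : EB × ((EB × EF) [⋀^Fin 2]→L[ℝ] ℝ) => vertContract x.1 x.2 := by
  refine DiffForm.contDiff_compContinuousLinearMap.comp (ContDiff.prodMk ?_ contDiff_const)
  have h : ContDiff ℝ ∞ fun η : (EB × EF) [⋀^Fin 2]→L[ℝ] ℝ => η.curryLeft :=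
    contDiff_curryLeft
  exact (h.comp contDiff_snd).clm_apply (contDiff_fst.prodMk contDiff_const)

/-- The vertical part of the homotopy operator contracting `EB × V` to `{0} × V`. -/
noncomputable def vertPrimitive (η : EB × EF → (EB × EF) [⋀^Fin 2]→L[ℝ] ℝ) :
    EB × EF → (EB × EF) [⋀^Fin 1]→L[ℝ] ℝ :=
  fun q => ∫ t in (0 : ℝ)..1, vertContract q.1 (η (t • q.1, q.2))

variable {η : EB × EF → (EB × EF) [⋀^Fin 2]→L[ℝ] ℝ} {V : Set EF}

/-- The first factor of the domain is the whole vector space, so every dilation `y ↦ t • y`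
preserves the domain. -/
theorem ContDiffOn.comp_fibrewise_dilation {W W' : Type*} [NormedAddCommGroup W] [NormedSpace ℝ W]
    [NormedAddCommGroup W'] [NormedSpace ℝ W'] {c : EB → W → W'}
    (hc : ContDiff ℝ ∞ fun x : EB × W => c x.1 x.2) {η : EB × EF → W}
    (hη : ContDiffOn ℝ ∞ η (univ ×ˢ V)) :
    ContDiffOn ℝ ∞ (fun x : (EB × EF) × ℝ => c x.1.1 (η (x.2 • x.1.1, x.1.2)))
      ((univ ×ˢ V) ×ˢ univ) := by
  have h1 : ContDiff ℝ ∞ fun x : (EB × EF) × ℝ => (x.2 • x.1.1, x.1.2) := by fun_prop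
  have h2 : ContDiff ℝ ∞ fun x : (EB × EF) × ℝ => x.1.1 := by fun_prop
  have h3 : ContDiffOn ℝ ∞ (fun x : (EB × EF) × ℝ => (x.1.1, η (x.2 • x.1.1, x.1.2)))
      ((univ ×ˢ V) ×ˢ univ) :=
    h2.contDiffOn.prodMk (hη.comp h1.contDiffOn fun x hx => ⟨mem_univ _, hx.1.2⟩)
  exact hc.comp_contDiffOn h3

theorem contDiffOn_vertPrimitive_integrand (hη : ContDiffOn ℝ ∞ η (univ ×ˢ V)) :
    ContDiffOn ℝ ∞ (fun x : (EB × EF) × ℝ => vertContract x.1.1 (η (x.2 • x.1.1, x.1.2)))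
      ((univ ×ˢ V) ×ˢ univ) :=
  ContDiffOn.comp_fibrewise_dilation (c := vertContract) contDiff_vertContract hη

theorem contDiffOn_vertPrimitive (hV : IsOpen V) (hη : ContDiffOn ℝ ∞ η (univ ×ˢ V)) :
    ContDiffOn ℝ ∞ (vertPrimitive η) (univ ×ˢ V) :=
  contDiffOn_parametric_intervalIntegral (isOpen_univ.prod hV)
    (contDiffOn_vertPrimitive_integrand hη)

theorem extDeriv_two_apply {E : Type*} [NormedAddCommGroup E] [NormedSpace ℝ E]
    {η : E → E [⋀^Fin 2]→L[ℝ] ℝ} {x : E} (h : DifferentiableAt ℝ η x) (a b c : E) :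
    extDeriv η x ![a, b, c] =
      fderiv ℝ η x a ![b, c] - fderiv ℝ η x b ![a, c] + fderiv ℝ η x c ![a, b] := by
  have h1 : ∀ v w, fderiv ℝ (fun y => η y v) x w = fderiv ℝ η x w v := fun v w => by
    rw [fderiv_continuousAlternatingMap_apply_const_apply h]
  rw [extDeriv_apply h]
  simp only [h1]
  have e0 : (0 : Fin 3).removeNth ![a, b, c] = ![b, c] := by ext i; fin_cases i <;> rfl
  have e1 : (1 : Fin 3).removeNth ![a, b, c] = ![a, c] := by ext i; fin_cases i <;> rfl
  have e2 : (2 : Fin 3).removeNth ![a, b, c] = ![a, b] := by ext i; fin_cases i <;> rfl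
  change ∑ i : Fin 3, (-1 : ℤ) ^ (i : ℕ) • fderiv ℝ η x (![a, b, c] i) (i.removeNth ![a, b, c]) = _
  rw [Fin.sum_univ_three, e0, e1, e2]
  simp
  ring

theorem extDeriv_one_apply {E : Type*} [NormedAddCommGroup E] [NormedSpace ℝ E]
    {η : E → E [⋀^Fin 1]→L[ℝ] ℝ} {x : E} (h : DifferentiableAt ℝ η x) (a b : E) :
    extDeriv η x ![a, b] = fderiv ℝ η x a ![b] - fderiv ℝ η x b ![a] := by
  have h1 : ∀ v w, fderiv ℝ (fun y => η y v) x w = fderiv ℝ η x w v := fun v w => by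
    rw [fderiv_continuousAlternatingMap_apply_const_apply h]
  rw [extDeriv_apply h]
  simp only [h1]
  have e0 : (0 : Fin 2).removeNth ![a, b] = ![b] := by ext i; fin_cases i; rfl
  have e1 : (1 : Fin 2).removeNth ![a, b] = ![a] := by ext i; fin_cases i; rfl
  change ∑ i : Fin 2, (-1 : ℤ) ^ (i : ℕ) • fderiv ℝ η x (![a, b] i) (i.removeNth ![a, b]) = _
  rw [Fin.sum_univ_two, e0, e1]
  simp
  ring

/-- A vertical displacement changes neither the contracted vector `q.1` nor the dilation, so the
derivative falls on `η` alone and no factor of `t` appears. -/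
theorem fderiv_vertPrimitive_apply (hV : IsOpen V) (hη : ContDiffOn ℝ ∞ η (univ ×ˢ V))
    {q : EB × EF} (hq : q.2 ∈ V) (v w : EF) :
    fderiv ℝ (vertPrimitive η) q (0, v) ![(0, w)] =
      ∫ t in (0 : ℝ)..1, fderiv ℝ η (t • q.1, q.2) (0, v) ![(q.1, 0), (0, w)] := by
  have hO : IsOpen ((univ : Set EB) ×ˢ V) := isOpen_univ.prod hV
  have hq' : q ∈ (univ : Set EB) ×ˢ V := ⟨mem_univ _, hq⟩
  have hint := contDiffOn_vertPrimitive_integrand hη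
  set f : (EB × EF) × ℝ → (EB × EF) [⋀^Fin 1]→L[ℝ] ℝ :=
    fun x => vertContract x.1.1 (η (x.2 • x.1.1, x.1.2)) with hf
  let T1 : ((EB × EF) [⋀^Fin 1]→L[ℝ] ℝ) →L[ℝ] ℝ :=
    ⟨{ toFun := fun L => L ![(0, w)], map_add' := fun _ _ => rfl, map_smul' := fun _ _ => rfl },
      ContinuousEvalConst.continuous_eval_const _⟩
  refine (fderiv_parametric_intervalIntegral_apply hO (hint.of_le (by simp)) hq' (0, v)
    T1).trans ?_
  refine intervalIntegral.integral_congr fun t _ => ?_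
  have hdf : HasFDerivAt f (fderiv ℝ f (q, t)) (q, t) :=
    ((hint.contDiffAt ((hO.prod isOpen_univ).mem_nhds ⟨hq', mem_univ t⟩)).differentiableAt
      (by simp)).hasFDerivAt
  have hdη : HasFDerivAt η (fderiv ℝ η (t • q.1, q.2)) (t • q.1, q.2) :=
    ((hη.contDiffAt (hO.mem_nhds (x := (t • q.1, q.2)) ⟨mem_univ _, hq⟩)).differentiableAt
      (by simp)).hasFDerivAt
  -- compare both sides along the line `s ↦ q + s (0, v)`
  have hl1 : HasDerivAt (fun s : ℝ => f ((q.1, q.2 + s • v), t))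
      (fderiv ℝ f (q, t) ((0, v), 0)) 0 := by
    have hl : HasDerivAt (fun s : ℝ => ((q.1, q.2 + s • v), t))
        (((0 : EB), v), (0 : ℝ)) 0 := by
      refine HasDerivAt.prodMk (HasDerivAt.prodMk (hasDerivAt_const _ _) ?_) (hasDerivAt_const _ _)
      simpa using ((hasDerivAt_id (0 : ℝ)).smul_const v).const_add q.2
    refine HasFDerivAt.comp_hasDerivAt_of_eq (0 : ℝ) hdf hl (by simp)
  have hl2 : HasDerivAt (fun s : ℝ => η (t • q.1, q.2 + s • v))
      (fderiv ℝ η (t • q.1, q.2) (0, v)) 0 := by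
    have hl : HasDerivAt (fun s : ℝ => (t • q.1, q.2 + s • v)) ((0 : EB), v) 0 := by
      refine HasDerivAt.prodMk (hasDerivAt_const _ _) ?_
      simpa using ((hasDerivAt_id (0 : ℝ)).smul_const v).const_add q.2
    refine HasFDerivAt.comp_hasDerivAt_of_eq (0 : ℝ) hdη hl (by simp)
  let T2 : ((EB × EF) [⋀^Fin 2]→L[ℝ] ℝ) →L[ℝ] ℝ :=
    ⟨{ toFun := fun L => L ![(q.1, 0), (0, w)]
       map_add' := fun _ _ => rfl, map_smul' := fun _ _ => rfl },
      ContinuousEvalConst.continuous_eval_const _⟩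
  have h3 := T1.hasFDerivAt.comp_hasDerivAt (0 : ℝ) hl1
  have h4 := T2.hasFDerivAt.comp_hasDerivAt (0 : ℝ) hl2
  refine h3.unique (h4.congr_of_eventuallyEq (Filter.Eventually.of_forall fun s => ?_))
  change vertContract q.1 _ ![((0 : EB), w)] = _
  rw [vertContract_apply]
  rfl

/-- By closedness, the `t`-derivative of `η` at `(t • y, z)` on two vertical vectors equals the
antisymmetrized vertical derivative of `η ((y, 0), ·)`. Integrating from 0 to 1 gives the difference
of end values. Components with a horizontal argument are never needed, which is why a truncated
homotopy operator suffices. -/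
theorem extDeriv_vertPrimitive_apply (hV : IsOpen V) (hη : ContDiffOn ℝ ∞ η (univ ×ˢ V))
    {q : EB × EF} (hq : q.2 ∈ V) (hclosed : ∀ t : ℝ, extDeriv η (t • q.1, q.2) = 0) (v w : EF) :
    extDeriv (vertPrimitive η) q ![(0, v), (0, w)] =
      η q ![(0, v), (0, w)] - η (0, q.2) ![(0, v), (0, w)] := by
  have hO : IsOpen ((univ : Set EB) ×ˢ V) := isOpen_univ.prod hV
  have hd : ∀ t : ℝ, DifferentiableAt ℝ η (t • q.1, q.2) := fun t =>
    (hη.contDiffAt (hO.mem_nhds (x := (t • q.1, q.2)) ⟨mem_univ _, hq⟩)).differentiableAt (by simp)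
  have hline : Continuous fun t : ℝ => (t • q.1, q.2) := by fun_prop
  have hfd : Continuous fun t : ℝ => fderiv ℝ η (t • q.1, q.2) :=
    (hη.continuousOn_fderiv_of_isOpen hO (by simp)).comp_continuous hline
      fun t => ⟨mem_univ _, hq⟩
  have hcont : ∀ (a : EB × EF) (b : Fin 2 → EB × EF),
      Continuous fun t : ℝ => fderiv ℝ η (t • q.1, q.2) a b := fun a b =>
    (ContinuousEvalConst.continuous_eval_const b).comp
      ((ContinuousEvalConst.continuous_eval_const a).comp hfd)
  rw [extDeriv_one_apply ((contDiffOn_vertPrimitive hV hη).contDiffAt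
    (hO.mem_nhds ⟨mem_univ _, hq⟩) |>.differentiableAt (by simp)),
    fderiv_vertPrimitive_apply hV hη hq, fderiv_vertPrimitive_apply hV hη hq,
    ← intervalIntegral.integral_sub ((hcont _ _).intervalIntegrable _ _)
      ((hcont _ _).intervalIntegrable _ _)]
  let T : ((EB × EF) [⋀^Fin 2]→L[ℝ] ℝ) →L[ℝ] ℝ :=
    ⟨{ toFun := fun L => L ![(0, v), (0, w)]
       map_add' := fun _ _ => rfl, map_smul' := fun _ _ => rfl },
      ContinuousEvalConst.continuous_eval_const _⟩
  -- The velocity of the path `t ↦ (t • q.1, q.2)` is the constant vector `(q.1, 0)`.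
  have hder : ∀ t ∈ uIcc (0 : ℝ) 1, HasDerivAt (fun t : ℝ => η (t • q.1, q.2) ![(0, v), (0, w)])
      (fderiv ℝ η (t • q.1, q.2) (q.1, 0) ![(0, v), (0, w)]) t := fun t _ => by
    have hl : HasDerivAt (fun t : ℝ => (t • q.1, q.2)) (q.1, (0 : EF)) t := by
      refine HasDerivAt.prodMk ?_ (hasDerivAt_const _ _)
      simpa using (hasDerivAt_id t).smul_const q.1
    exact T.hasFDerivAt.comp_hasDerivAt t ((hd t).hasFDerivAt.comp_hasDerivAt t hl)
  have hftc := intervalIntegral.integral_eq_sub_of_hasDerivAt hder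
    ((hcont _ _).intervalIntegrable _ _)
  simp only [one_smul, zero_smul] at hftc
  rw [← hftc]
  refine intervalIntegral.integral_congr fun t _ => ?_
  have h := extDeriv_two_apply (hd t) (q.1, 0) (0, v) (0, w)
  rw [hclosed t] at h
  have h0 : (0 : (EB × EF) [⋀^Fin 3]→L[ℝ] ℝ) ![(q.1, 0), (0, v), (0, w)] = 0 := rfl
  rw [h0] at h
  change _ - _ = _
  linarith

end VerticalHomotopy

namespace DiffForm

/-! ### Values and pullbacks of forms expressed on the fixed model spaces. -/

section PointwiseForms

variable (E : Type*) [NormedAddCommGroup E] [NormedSpace ℝ E]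
variable {M : Type*} [TopologicalSpace M] [ChartedSpace E M]
variable (E' : Type*) [NormedAddCommGroup E'] [NormedSpace ℝ E']
variable {N : Type*} [TopologicalSpace N] [ChartedSpace E' N]

/-- The differential of `f` at `x`, as a map between the model spaces. -/
noncomputable def tmap (f : M → N) (x : M) : E →L[ℝ] E' := mfderiv 𝓘(ℝ, E) 𝓘(ℝ, E') f x

variable {E E'}

/-- The value of a form at `x`, as an alternating form on the model space. -/
def evalAt {k : ℕ} (σ : FormField E M k) (x : M) : E [⋀^Fin k]→L[ℝ] ℝ := σ x

theorem formField_ext {k : ℕ} {σ η : FormField E M k} (h : ∀ x, evalAt σ x = evalAt η x) :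
    σ = η := funext h

theorem evalAt_pullback {k : ℕ} (f : M → N) (σ : FormField E' N k) (x : M) :
    evalAt (pullback f σ : FormField E M k) x =
      (evalAt σ (f x)).compContinuousLinearMap (tmap E E' f x) := rfl

theorem localRep_eq {k : ℕ} (σ : FormField E M k) (c : OpenPartialHomeomorph M E) (y : E) :
    localRep σ c y = (evalAt σ (c.symm y)).compContinuousLinearMap (tmap E E c.symm y) := rfl

theorem evalAt_extD {k : ℕ} (σ : FormField E M k) (x : M) :
    evalAt (extD σ) x = (extDeriv (localRep σ (chartAt E x))
      (chartAt E x x)).compContinuousLinearMap (tmap E E (chartAt E x) x) := rfl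

theorem evalAt_add {k : ℕ} (σ η : FormField E M k) (x : M) :
    evalAt (σ + η) x = evalAt σ x + evalAt η x := rfl

theorem evalAt_sub {k : ℕ} (σ η : FormField E M k) (x : M) :
    evalAt (σ - η) x = evalAt σ x - evalAt η x := rfl

theorem evalAt_smul {k : ℕ} (a : ℝ) (σ : FormField E M k) (x : M) :
    evalAt (a • σ) x = a • evalAt σ x := rfl

theorem pullback_sub {k : ℕ} (f : M → N) (σ η : FormField E' N k) :
    (pullback f (σ - η) : FormField E M k) = pullback f σ - pullback f η := rfl

theorem tmap_comp {E'' : Type*} [NormedAddCommGroup E''] [NormedSpace ℝ E'']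
    {L : Type*} [TopologicalSpace L] [ChartedSpace E'' L] {g : N → L} {f : M → N} {x : M}
    (hg : MDifferentiableAt 𝓘(ℝ, E') 𝓘(ℝ, E'') g (f x))
    (hf : MDifferentiableAt 𝓘(ℝ, E) 𝓘(ℝ, E') f x) :
    tmap E E'' (g ∘ f) x = (tmap E' E'' g (f x)).comp (tmap E E' f x) := mfderiv_comp x hg hf

theorem tmap_id (x : M) : tmap E E (id : M → M) x = ContinuousLinearMap.id ℝ E := mfderiv_id

theorem compContinuousLinearMap_comp {G G' G'' : Type*} [NormedAddCommGroup G] [NormedSpace ℝ G]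
    [NormedAddCommGroup G'] [NormedSpace ℝ G'] [NormedAddCommGroup G''] [NormedSpace ℝ G'']
    {k : ℕ} (α : G [⋀^Fin k]→L[ℝ] ℝ) (A : G' →L[ℝ] G) (B : G'' →L[ℝ] G') :
    (α.compContinuousLinearMap A).compContinuousLinearMap B =
      α.compContinuousLinearMap (A.comp B) := rfl

theorem compContinuousLinearMap_id' {k : ℕ} (α : E [⋀^Fin k]→L[ℝ] ℝ) :
    α.compContinuousLinearMap (ContinuousLinearMap.id ℝ E) = α := rfl

theorem pullback_comp {E'' : Type*} [NormedAddCommGroup E''] [NormedSpace ℝ E'']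
    {L : Type*} [TopologicalSpace L] [ChartedSpace E'' L] {g : N → L} {f : M → N}
    (hg : ∀ x, MDifferentiableAt 𝓘(ℝ, E') 𝓘(ℝ, E'') g (f x))
    (hf : ∀ x, MDifferentiableAt 𝓘(ℝ, E) 𝓘(ℝ, E') f x) {k : ℕ} (σ : FormField E'' L k) :
    (pullback (g ∘ f) σ : FormField E M k) = pullback f (pullback g σ : FormField E' N k) :=
  formField_ext fun x => by
    rw [evalAt_pullback, evalAt_pullback, evalAt_pullback, tmap_comp (hg x) (hf x)]
    rfl

theorem tmap_symm_chartAt_comp [IsManifold 𝓘(ℝ, E) ∞ M] (x₀ : M) {z : E}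
    (hz : z ∈ (chartAt E x₀).target) :
    (tmap E E (chartAt E x₀).symm z).comp (tmap E E (chartAt E x₀) ((chartAt E x₀).symm z)) =
      ContinuousLinearMap.id ℝ E := by
  have h := (mdifferentiable_chart (I := 𝓘(ℝ, E)) x₀).symm_comp_deriv
    ((chartAt E x₀).map_target hz)
  rw [(chartAt E x₀).right_inv hz] at h
  exact h

theorem tmap_chartAt_comp_symm [IsManifold 𝓘(ℝ, E) ∞ M] (x₀ : M) {z : E}
    (hz : z ∈ (chartAt E x₀).target) :
    (tmap E E (chartAt E x₀) ((chartAt E x₀).symm z)).comp (tmap E E (chartAt E x₀).symm z) =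
      ContinuousLinearMap.id ℝ E :=
  (mdifferentiable_chart (I := 𝓘(ℝ, E)) x₀).comp_symm_deriv hz

end PointwiseForms

/-! ### Forms on the product of a vector space and a manifold. -/

section ProductWithVectorSpace

universe u v

variable {EB : Type u} [NormedAddCommGroup EB] [NormedSpace ℝ EB]
variable {EF : Type v} [NormedAddCommGroup EF] [NormedSpace ℝ EF]
variable {F : Type*} [TopologicalSpace F] [ChartedSpace EF F]

/-- The product of a vector space and a manifold, modelled on the product vector space. -/
noncomputable instance (priority := low) prodSelfChartedSpace : ChartedSpace (EB × EF) (EB × F) :=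
  inferInstanceAs (ChartedSpace (ModelProd EB EF) (EB × F))

instance [IsManifold 𝓘(ℝ, EF) ∞ F] : IsManifold 𝓘(ℝ, EB × EF) ∞ (EB × F) := by
  rw [modelWithCornersSelf_prod]
  exact IsManifold.prod (I := 𝓘(ℝ, EB)) (I' := 𝓘(ℝ, EF)) EB F

variable {E' : Type*} [NormedAddCommGroup E'] [NormedSpace ℝ E']
variable {N : Type*} [TopologicalSpace N] [ChartedSpace E' N]

theorem contMDiff_prodSelf_dom {f : EB × F → N}
    (hf : ContMDiff (𝓘(ℝ, EB).prod 𝓘(ℝ, EF)) 𝓘(ℝ, E') ∞ f) :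
    ContMDiff 𝓘(ℝ, EB × EF) 𝓘(ℝ, E') ∞ f := by
  rw [modelWithCornersSelf_prod]
  exact hf

theorem contMDiffOn_prodSelf_cod {f : N → EB × F} {s : Set N}
    (hf : ContMDiffOn 𝓘(ℝ, E') (𝓘(ℝ, EB).prod 𝓘(ℝ, EF)) ∞ f s) :
    ContMDiffOn 𝓘(ℝ, E') 𝓘(ℝ, EB × EF) ∞ f s := by
  rw [modelWithCornersSelf_prod]
  exact hf

theorem contMDiff_prodSelf_snd : ContMDiff 𝓘(ℝ, EB × EF) 𝓘(ℝ, EF) ∞ (Prod.snd : EB × F → F) :=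
  contMDiff_prodSelf_dom contMDiff_snd

theorem contMDiff_prodSelf_mk (y : EB) :
    ContMDiff 𝓘(ℝ, EF) 𝓘(ℝ, EB × EF) ∞ (fun f : F => (y, f)) :=
  contMDiffOn_univ.1 (contMDiffOn_prodSelf_cod
    (contMDiffOn_univ.2 (contMDiff_const.prodMk contMDiff_id)))

theorem tmap_prodSelf_mk (y : EB) (f : F) :
    tmap EF (EB × EF) (fun f : F => (y, f)) f = ContinuousLinearMap.inr ℝ EB EF := by
  rw [tmap, modelWithCornersSelf_prod]
  exact mfderiv_prod_right (I := 𝓘(ℝ, EB)) (I' := 𝓘(ℝ, EF)) (x₀ := y) (y₀ := f)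

theorem evalAt_pullback_prodSelf_mk {k : ℕ} (η : FormField (EB × EF) (EB × F) k) (y : EB) (f : F) :
    evalAt (pullback (fun f : F => (y, f)) η : FormField EF F k) f =
      (evalAt η (y, f)).compContinuousLinearMap (ContinuousLinearMap.inr ℝ EB EF) := by
  rw [evalAt_pullback, tmap_prodSelf_mk]

/-- The vertical part of the homotopy operator of `EB × F` contracting the first factor. -/
noncomputable def vertHomotopy (η : FormField (EB × EF) (EB × F) 2) :
    FormField (EB × EF) (EB × F) 1 :=
  fun q => (∫ t in (0 : ℝ)..1, vertContract q.1 (evalAt η (t • q.1, q.2)) :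
    (EB × EF) [⋀^Fin 1]→L[ℝ] ℝ)

variable [IsManifold 𝓘(ℝ, EF) ∞ F]

/-- The chart of `EB × F` at `q` is the identity times a chart of `F`, so its differential is block
diagonal and passing to coordinates does not mix base and fibre directions. -/
theorem tmap_chartAt_prodSelf_symm (q : EB × F) {x : EB × EF}
    (hx : x.2 ∈ (chartAt EF q.2).target) :
    tmap (EB × EF) (EB × EF) (chartAt (EB × EF) q).symm x =
      (ContinuousLinearMap.id ℝ EB).prodMap (tmap EF EF (chartAt EF q.2).symm x.2) := by
  have h2 : MDifferentiableAt 𝓘(ℝ, EF) 𝓘(ℝ, EF) (chartAt EF q.2).symm x.2 :=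
    mdifferentiableAt_atlas_symm (chart_mem_atlas EF q.2) hx
  have h1 : MDifferentiableAt 𝓘(ℝ, EB) 𝓘(ℝ, EB) (id : EB → EB) x.1 := mdifferentiableAt_id
  have h := mfderiv_prodMap h1 h2
  rw [mfderiv_id, chartedSpaceSelf_prod] at h
  rw [tmap, modelWithCornersSelf_prod]
  exact h

theorem tmap_chartAt_prodSelf (q : EB × F) :
    tmap (EB × EF) (EB × EF) (chartAt (EB × EF) q) q =
      (ContinuousLinearMap.id ℝ EB).prodMap (tmap EF EF (chartAt EF q.2) q.2) := by
  have h2 : MDifferentiableAt 𝓘(ℝ, EF) 𝓘(ℝ, EF) (chartAt EF q.2) q.2 :=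
    mdifferentiableAt_atlas (chart_mem_atlas EF q.2) (mem_chart_source EF q.2)
  have h1 : MDifferentiableAt 𝓘(ℝ, EB) 𝓘(ℝ, EB) (id : EB → EB) q.1 := mdifferentiableAt_id
  have h := mfderiv_prodMap h1 h2
  rw [mfderiv_id, chartedSpaceSelf_prod] at h
  rw [tmap, modelWithCornersSelf_prod]
  exact h

theorem localRep_prodSelf {k : ℕ} (η : FormField (EB × EF) (EB × F) k) (q : EB × F)
    {x : EB × EF} (hx : x.2 ∈ (chartAt EF q.2).target) :
    localRep η (chartAt (EB × EF) q) x =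
      (evalAt η (x.1, (chartAt EF q.2).symm x.2)).compContinuousLinearMap
        ((ContinuousLinearMap.id ℝ EB).prodMap (tmap EF EF (chartAt EF q.2).symm x.2)) := by
  rw [localRep_eq, tmap_chartAt_prodSelf_symm q hx]
  rfl

theorem evalAt_prodSelf_eq_localRep {k : ℕ} (η : FormField (EB × EF) (EB × F) k) (q : EB × F)
    {x : EB × EF} (hx : x.2 ∈ (chartAt EF q.2).target) :
    evalAt η (x.1, (chartAt EF q.2).symm x.2) =
      (localRep η (chartAt (EB × EF) q) x).compContinuousLinearMap
        ((ContinuousLinearMap.id ℝ EB).prodMap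
          (tmap EF EF (chartAt EF q.2) ((chartAt EF q.2).symm x.2))) := by
  have h : ((ContinuousLinearMap.id ℝ EB).prodMap (tmap EF EF (chartAt EF q.2).symm x.2)).comp
      ((ContinuousLinearMap.id ℝ EB).prodMap
        (tmap EF EF (chartAt EF q.2) ((chartAt EF q.2).symm x.2))) =
      ContinuousLinearMap.id ℝ (EB × EF) :=
    ContinuousLinearMap.ext fun w =>
      Prod.ext rfl (DFunLike.congr_fun (tmap_symm_chartAt_comp q.2 hx) w.2)
  rw [localRep_prodSelf η q hx, compContinuousLinearMap_comp, h, compContinuousLinearMap_id']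

end ProductWithVectorSpace

/-! ### The vertical homotopy operator on `EB × F`. -/

section VertHomotopy

universe u v

variable {EB : Type u} [NormedAddCommGroup EB] [NormedSpace ℝ EB]
variable {EF : Type v} [NormedAddCommGroup EF] [NormedSpace ℝ EF]
variable {F : Type*} [TopologicalSpace F] [ChartedSpace EF F] [IsManifold 𝓘(ℝ, EF) ∞ F]

/-- A map `id × a` fixes `(y, 0)` and sends vertical vectors to vertical vectors. -/
theorem vertContract_compContinuousLinearMap (y : EB) (α : (EB × EF) [⋀^Fin 2]→L[ℝ] ℝ)
    (a : EF →L[ℝ] EF) :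
    vertContract y (α.compContinuousLinearMap ((ContinuousLinearMap.id ℝ EB).prodMap a)) =
      (vertContract y α).compContinuousLinearMap ((ContinuousLinearMap.id ℝ EB).prodMap a) := by
  ext w
  rw [ContinuousAlternatingMap.compContinuousLinearMap_apply, vertContract_apply,
    vertContract_apply, ContinuousAlternatingMap.compContinuousLinearMap_apply]
  congr 1
  funext i
  fin_cases i <;> simp

/-- The dilation leaves the point of `F` fixed, so a single linear map, independent of `t`, passes
to coordinates along the whole path and can be taken out of the integral. -/
theorem localRep_vertHomotopy {η : FormField (EB × EF) (EB × F) 2} (hη : IsSmooth η) (q : EB × F)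
    {x : EB × EF} (hx : x.2 ∈ (chartAt EF q.2).target) :
    localRep (vertHomotopy η) (chartAt (EB × EF) q) x =
      vertPrimitive (localRep η (chartAt (EB × EF) q)) x := by
  let h : ℝ → (EB × EF) [⋀^Fin 1]→L[ℝ] ℝ := fun t =>
    vertContract x.1 (evalAt η (t • x.1, (chartAt EF q.2).symm x.2))
  let J : ℝ → (EB × EF) [⋀^Fin 1]→L[ℝ] ℝ := fun t =>
    vertContract x.1 (localRep η (chartAt (EB × EF) q) (t • x.1, x.2))
  have hJ : Continuous J := by
    have h1 : ContDiffOn ℝ ∞ (localRep η (chartAt (EB × EF) q))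
      (univ ×ˢ (chartAt EF q.2).target) := hη q
    exact (contDiffOn_vertPrimitive_integrand h1).continuousOn.comp_continuous
      (f := fun t : ℝ => (x, t)) (by fun_prop) fun t => ⟨⟨mem_univ _, hx⟩, mem_univ _⟩
  -- Integrability of `h` is not given directly; writing `h` through the coordinate integrand `J`
  -- transfers continuity to it.
  have hh : ∀ t, h t = (J t).compContinuousLinearMap ((ContinuousLinearMap.id ℝ EB).prodMap
      (tmap EF EF (chartAt EF q.2) ((chartAt EF q.2).symm x.2))) := fun t => by
    change vertContract x.1 _ = (vertContract x.1 _).compContinuousLinearMap _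
    rw [← vertContract_compContinuousLinearMap,
      ← evalAt_prodSelf_eq_localRep η q (x := (t • x.1, x.2)) hx]
  have hJh : ∀ t, J t = (h t).compContinuousLinearMap ((ContinuousLinearMap.id ℝ EB).prodMap
      (tmap EF EF (chartAt EF q.2).symm x.2)) := fun t => by
    change vertContract x.1 _ = (vertContract x.1 _).compContinuousLinearMap _
    rw [localRep_prodSelf η q (x := (t • x.1, x.2)) hx, vertContract_compContinuousLinearMap]
  have hhc : Continuous h := by
    rw [show h = _ from funext hh]
    exact (ContinuousAlternatingMap.compContinuousLinearMapCLM _).continuous.comp hJ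
  rw [localRep_prodSelf _ q hx]
  change (∫ t in (0 : ℝ)..1, h t).compContinuousLinearMap _ = ∫ t in (0 : ℝ)..1, J t
  rw [show J = _ from funext hJh]
  exact (ContinuousLinearMap.intervalIntegral_comp_comm
    (F := (EB × EF) [⋀^Fin 1]→L[ℝ] ℝ) (E := (EB × EF) [⋀^Fin 1]→L[ℝ] ℝ)
    (ContinuousAlternatingMap.compContinuousLinearMapCLM _) (hhc.intervalIntegrable 0 1)).symm

theorem IsSmooth.vertHomotopy {η : FormField (EB × EF) (EB × F) 2} (hη : IsSmooth η) :
    IsSmooth (vertHomotopy η) := fun q =>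
  (contDiffOn_vertPrimitive (chartAt EF q.2).open_target (hη q)).congr fun _ hx =>
    localRep_vertHomotopy hη q hx.2

theorem pullback_extD_vertHomotopy {η : FormField (EB × EF) (EB × F) 2}
    (hη : η ∈ closedForms (EB × EF) (EB × F) 2) (y : EB) :
    (pullback (fun f : F => (y, f)) (extD (vertHomotopy η)) : FormField EF F 2) =
      pullback (fun f : F => (y, f)) η - pullback (fun f : F => ((0 : EB), f)) η := by
  refine formField_ext fun f => ?_
  set c := chartAt EF f
  set τ := localRep η (chartAt (EB × EF) (y, f)) with hτ
  have hcf : c.symm (c f) = f := c.left_inv (mem_chart_source EF f)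
  have hz : c f ∈ c.target := mem_chart_target EF f
  have hV : IsOpen c.target := c.open_target
  have hsm : ContDiffOn ℝ ∞ τ (univ ×ˢ c.target) := hη.1 (y, f)
  -- The charts at all points `(t • y, f)` coincide, so closedness along the path can be read off
  -- from the single coordinate expression `τ`.
  have hclosed : ∀ t : ℝ, extDeriv τ (t • y, c f) = 0 := fun t => by
    have h1 : evalAt (extD η) (t • y, f) = 0 := by rw [hη.2]; rfl
    rw [evalAt_extD, tmap_chartAt_prodSelf] at h1
    have h2 := tmap_chartAt_comp_symm f hz
    rw [hcf] at h2
    have h3 : ((ContinuousLinearMap.id ℝ EB).prodMap (tmap EF EF c f)).comp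
        ((ContinuousLinearMap.id ℝ EB).prodMap (tmap EF EF c.symm (c f))) =
        ContinuousLinearMap.id ℝ (EB × EF) :=
      ContinuousLinearMap.ext fun w => Prod.ext rfl (DFunLike.congr_fun h2 w.2)
    have h4 := congrArg (fun α : (EB × EF) [⋀^Fin 3]→L[ℝ] ℝ => α.compContinuousLinearMap
      ((ContinuousLinearMap.id ℝ EB).prodMap (tmap EF EF c.symm (c f)))) h1
    simp only [compContinuousLinearMap_comp] at h4
    rw [h3, compContinuousLinearMap_id'] at h4
    exact h4
  have hext : ∀ v w : EF, extDeriv (localRep (vertHomotopy η) (chartAt (EB × EF) (y, f)))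
      (y, c f) ![(0, v), (0, w)] = τ (y, c f) ![(0, v), (0, w)] - τ (0, c f) ![(0, v), (0, w)] :=
    fun v w => by
    rw [← extDeriv_vertPrimitive_apply hV hsm (q := (y, c f)) hz hclosed v w]
    have hev : localRep (vertHomotopy η) (chartAt (EB × EF) (y, f)) =ᶠ[𝓝 (y, c f)]
        vertPrimitive τ := by
      filter_upwards [(isOpen_univ.prod hV).mem_nhds (x := (y, c f)) ⟨mem_univ _, hz⟩] with x hx
      exact localRep_vertHomotopy hη.1 (y, f) hx.2
    rw [hev.extDeriv_eq]
  have hη' : ∀ y' : EB, evalAt η (y', f) = (τ (y', c f)).compContinuousLinearMap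
      ((ContinuousLinearMap.id ℝ EB).prodMap (tmap EF EF c f)) := fun y' => by
    have h4 := evalAt_prodSelf_eq_localRep η (y, f) (x := (y', c f)) hz
    change evalAt η (y', c.symm (c f)) = (τ (y', c f)).compContinuousLinearMap
      ((ContinuousLinearMap.id ℝ EB).prodMap (tmap EF EF c (c.symm (c f)))) at h4
    rwa [hcf] at h4
  rw [evalAt_sub, evalAt_pullback_prodSelf_mk, evalAt_pullback_prodSelf_mk,
    evalAt_pullback_prodSelf_mk, hη', hη', evalAt_extD, tmap_chartAt_prodSelf]
  ext w
  have hvec : ∀ α : (EB × EF) [⋀^Fin 2]→L[ℝ] ℝ,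
      ((α.compContinuousLinearMap ((ContinuousLinearMap.id ℝ EB).prodMap
        (tmap EF EF c f))).compContinuousLinearMap (ContinuousLinearMap.inr ℝ EB EF)) w =
      α ![(0, tmap EF EF c f (w 0)), (0, tmap EF EF c f (w 1))] := fun α =>
    congrArg α (funext fun i => by fin_cases i <;> rfl)
  refine (hvec _).trans ((hext _ _).trans ?_)
  rw [← hvec, ← hvec]
  rfl

end VertHomotopy

/-! ### Pullbacks along maps smooth on an open set, and cut-offs. -/

section LocalPullback

variable {E : Type*} [NormedAddCommGroup E] [NormedSpace ℝ E]
variable {M : Type*} [TopologicalSpace M] [ChartedSpace E M] [IsManifold 𝓘(ℝ, E) ∞ M]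
variable {E' : Type*} [NormedAddCommGroup E'] [NormedSpace ℝ E']
variable {N : Type*} [TopologicalSpace N] [ChartedSpace E' N] [IsManifold 𝓘(ℝ, E') ∞ N]
variable {f : N → M} {U : Set N}

theorem contDiffAt_coord_of_contMDiffOn (hU : IsOpen U)
    (hf : ContMDiffOn 𝓘(ℝ, E') 𝓘(ℝ, E) ∞ f U) (x₀ : N) (z : M)
    {y : E'} (hy : y ∈ (chartAt E' x₀).target) (hyU : (chartAt E' x₀).symm y ∈ U)
    (hz : f ((chartAt E' x₀).symm y) ∈ (chartAt E z).source) :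
    ContDiffAt ℝ ∞ (fun y => chartAt E z (f ((chartAt E' x₀).symm y))) y := by
  rw [← contMDiffAt_iff_contDiffAt]
  have h1 : ContMDiffAt 𝓘(ℝ, E') 𝓘(ℝ, E') ∞ (chartAt E' x₀).symm y :=
    contMDiffAt_symm_of_mem_maximalAtlas (IsManifold.chart_mem_maximalAtlas x₀) hy
  have h2 : ContMDiffAt 𝓘(ℝ, E) 𝓘(ℝ, E) ∞ (chartAt E z) (f ((chartAt E' x₀).symm y)) :=
    contMDiffAt_of_mem_maximalAtlas (IsManifold.chart_mem_maximalAtlas z) hz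
  exact h2.comp y ((hf.contMDiffAt (hU.mem_nhds hyU)).comp y h1)

/-- Coordinates adapted to the fibration are smooth only over an open set, so naturality of
coordinate expressions is needed locally. -/
theorem localRep_pullback_of_contMDiffOn {k : ℕ} (hU : IsOpen U)
    (hf : ContMDiffOn 𝓘(ℝ, E') 𝓘(ℝ, E) ∞ f U) (σ : FormField E M k) (x₀ : N) (z : M)
    {y : E'} (hy : y ∈ (chartAt E' x₀).target) (hyU : (chartAt E' x₀).symm y ∈ U)
    (hz : f ((chartAt E' x₀).symm y) ∈ (chartAt E z).source) :
    localRep (pullback f σ : FormField E' N k) (chartAt E' x₀) =ᶠ[𝓝 y]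
      fun y => (localRep σ (chartAt E z)
          (chartAt E z (f ((chartAt E' x₀).symm y)))).compContinuousLinearMap
        (fderiv ℝ (fun y => chartAt E z (f ((chartAt E' x₀).symm y))) y) := by
  have hc : ContinuousAt (fun y => f ((chartAt E' x₀).symm y)) y :=
    ContinuousAt.comp (hf.contMDiffAt (hU.mem_nhds hyU)).continuousAt
      ((chartAt E' x₀).symm.continuousAt hy)
  have hev : ∀ᶠ y' in 𝓝 y, (y' ∈ (chartAt E' x₀).target ∧ (chartAt E' x₀).symm y' ∈ U) ∧
      f ((chartAt E' x₀).symm y') ∈ (chartAt E z).source :=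
    Filter.Eventually.and (Filter.Eventually.and ((chartAt E' x₀).open_target.mem_nhds hy)
      (((chartAt E' x₀).symm.continuousAt hy).preimage_mem_nhds (hU.mem_nhds hyU)))
      (hc.preimage_mem_nhds ((chartAt E z).open_source.mem_nhds hz))
  filter_upwards [hev.eventually_nhds] with y' hy'
  obtain ⟨⟨hy1, hyU'⟩, hy2⟩ := hy'.self_of_nhds
  have hg := contDiffAt_coord_of_contMDiffOn hU hf x₀ z hy1 hyU' hy2
  set g := fun y => chartAt E z (f ((chartAt E' x₀).symm y)) with hgdef
  have h1 : MDifferentiableAt 𝓘(ℝ, E') 𝓘(ℝ, E') (chartAt E' x₀).symm y' :=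
    mdifferentiableAt_atlas_symm (chart_mem_atlas E' x₀) hy1
  have h2 : MDifferentiableAt 𝓘(ℝ, E') 𝓘(ℝ, E) f ((chartAt E' x₀).symm y') :=
    (hf.contMDiffAt (hU.mem_nhds hyU')).mdifferentiableAt (by simp)
  have h3 : MDifferentiableAt 𝓘(ℝ, E') 𝓘(ℝ, E) g y' :=
    (hg.differentiableAt (by simp)).mdifferentiableAt
  have h4 : MDifferentiableAt 𝓘(ℝ, E) 𝓘(ℝ, E) (chartAt E z).symm (g y') :=
    mdifferentiableAt_atlas_symm (chart_mem_atlas E z) ((chartAt E z).map_source hy2)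
  have key : tmap E' E (f ∘ (chartAt E' x₀).symm) y' =
      tmap E' E ((chartAt E z).symm ∘ g) y' := by
    apply Filter.EventuallyEq.mfderiv_eq
    filter_upwards [hy'] with t ht
    exact ((chartAt E z).left_inv ht.2).symm
  rw [tmap_comp h2 h1, tmap_comp h4 h3] at key
  have hfd : tmap E' E g y' = fderiv ℝ g y' := mfderiv_eq_fderiv
  have hpt : (chartAt E z).symm (g y') = f ((chartAt E' x₀).symm y') := (chartAt E z).left_inv hy2
  change _ = (localRep σ (chartAt E z) (g y')).compContinuousLinearMap (fderiv ℝ g y')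
  rw [localRep_eq, localRep_eq, evalAt_pullback, compContinuousLinearMap_comp,
    compContinuousLinearMap_comp, key, hfd, hpt]

theorem contDiffAt_localRep_pullback {k : ℕ} (hU : IsOpen U)
    (hf : ContMDiffOn 𝓘(ℝ, E') 𝓘(ℝ, E) ∞ f U) {σ : FormField E M k} (hσ : IsSmooth σ) (x₀ : N)
    {y : E'} (hy : y ∈ (chartAt E' x₀).target) (hyU : (chartAt E' x₀).symm y ∈ U) :
    ContDiffAt ℝ ∞ (localRep (pullback f σ : FormField E' N k) (chartAt E' x₀)) y := by
  set z := f ((chartAt E' x₀).symm y)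
  have hz : z ∈ (chartAt E z).source := mem_chart_source E z
  have hg := contDiffAt_coord_of_contMDiffOn hU hf x₀ z hy hyU hz
  refine ContDiffAt.congr_of_eventuallyEq ?_
    (localRep_pullback_of_contMDiffOn hU hf σ x₀ z hy hyU hz)
  refine contDiff_compContinuousLinearMap.contDiffAt.comp y (ContDiffAt.prodMk ?_ ?_)
  · exact (hσ.contDiffAt z (mem_chart_target E z)).comp y hg
  · exact hg.fderiv_right (by simp)

/-- The product of a form with a function. -/
noncomputable def fmul {k : ℕ} (ρ : N → ℝ) (σ : FormField E' N k) : FormField E' N k :=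
  fun x => ρ x • σ x

omit [IsManifold 𝓘(ℝ, E') ∞ N] in
theorem evalAt_fmul {k : ℕ} (ρ : N → ℝ) (σ : FormField E' N k) (x : N) :
    evalAt (fmul ρ σ) x = ρ x • evalAt σ x := rfl

/-- Extension by zero: a point outside `U` has a neighbourhood disjoint from the support of `ρ`, so
it does not matter how the pullback behaves there. -/
theorem isSmooth_fmul_pullback {k : ℕ} (hU : IsOpen U)
    (hf : ContMDiffOn 𝓘(ℝ, E') 𝓘(ℝ, E) ∞ f U) {σ : FormField E M k} (hσ : IsSmooth σ)
    {ρ : N → ℝ} (hρ : ContMDiff 𝓘(ℝ, E') 𝓘(ℝ, ℝ) ∞ ρ) (hsupp : tsupport ρ ⊆ U) :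
    IsSmooth (fmul ρ (pullback f σ : FormField E' N k)) := by
  intro x₀ y hy
  refine ContDiffAt.contDiffWithinAt ?_
  by_cases hyU : (chartAt E' x₀).symm y ∈ U
  · have h1 : ContDiffAt ℝ ∞ (fun y => ρ ((chartAt E' x₀).symm y)) y := by
      rw [← contMDiffAt_iff_contDiffAt]
      exact (hρ _).comp y
        (contMDiffAt_symm_of_mem_maximalAtlas (IsManifold.chart_mem_maximalAtlas x₀) hy)
    exact h1.smul (contDiffAt_localRep_pullback hU hf hσ x₀ hy hyU)
  · have hopen : (tsupport ρ)ᶜ ∈ 𝓝 ((chartAt E' x₀).symm y) :=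
      (isClosed_tsupport ρ).isOpen_compl.mem_nhds fun h => hyU (hsupp h)
    refine (contDiffAt_const (c := 0)).congr_of_eventuallyEq ?_
    filter_upwards [((chartAt E' x₀).symm.continuousAt hy).preimage_mem_nhds hopen] with y' hy'
    rw [localRep_eq, evalAt_fmul, image_eq_zero_of_notMem_tsupport hy', zero_smul]
    rfl

end LocalPullback

/-! ### Chart independence of the exterior derivative, and `d² = 0`. -/

section ExteriorDerivative

variable {E : Type*} [NormedAddCommGroup E] [NormedSpace ℝ E]
variable {M : Type*} [TopologicalSpace M] [ChartedSpace E M] [IsManifold 𝓘(ℝ, E) ∞ M]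

/-- `extD` uses a different chart at each point. Naturality of `extDeriv` under the transition map,
obtained by pulling back along the identity, allows one chart for all nearby points. -/
theorem localRep_extD {k : ℕ} {σ : FormField E M k} (hσ : IsSmooth σ) (x₀ : M) {y : E}
    (hy : y ∈ (chartAt E x₀).target) :
    localRep (extD σ) (chartAt E x₀) y = extDeriv (localRep σ (chartAt E x₀)) y := by
  set c := chartAt E x₀
  set z := c.symm y
  have hz : z ∈ (chartAt E z).source := mem_chart_source E z
  have hg : ContDiffAt ℝ ∞ (fun y => chartAt E z (c.symm y)) y :=
    contDiffAt_coord (f := (id : M → M)) contMDiff_id x₀ z hy hz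
  have hL : localRep σ c =ᶠ[𝓝 y] fun y =>
      (localRep σ (chartAt E z) (chartAt E z (c.symm y))).compContinuousLinearMap
        (fderiv ℝ (fun y => chartAt E z (c.symm y)) y) := by
    have h := localRep_pullback (f := (id : M → M)) contMDiff_id σ x₀ z hy hz
    have hid : (pullback (id : M → M) σ : FormField E M k) = σ := formField_ext fun x => by
      rw [evalAt_pullback, tmap_id]; rfl
    rw [hid] at h
    exact h
  have hr2 : minSmoothness ℝ 2 ≤ (∞ : WithTop ℕ∞) := by
    rw [minSmoothness_of_isRCLikeNormedField]
    exact WithTop.coe_le_coe.2 (le_top : (2 : ℕ∞) ≤ ⊤)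
  have hd : extDeriv (localRep σ c) y = (extDeriv (localRep σ (chartAt E z))
      (chartAt E z z)).compContinuousLinearMap (fderiv ℝ (fun y => chartAt E z (c.symm y)) y) := by
    rw [hL.extDeriv_eq]
    exact extDeriv_pullback (r := ∞) (f := fun y => chartAt E z (c.symm y))
      (hσ.differentiableAt z) hg hr2
  have hcomp : tmap E E (chartAt E z ∘ c.symm) y =
      (tmap E E (chartAt E z) z).comp (tmap E E c.symm y) :=
    tmap_comp (mdifferentiableAt_atlas (chart_mem_atlas E z) hz)
      (mdifferentiableAt_atlas_symm (chart_mem_atlas E x₀) hy)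
  have hfd : tmap E E (chartAt E z ∘ c.symm) y = fderiv ℝ (fun y => chartAt E z (c.symm y)) y :=
    mfderiv_eq_fderiv
  rw [hd, ← hfd, hcomp, localRep_eq, evalAt_extD, compContinuousLinearMap_comp]

theorem IsSmooth.extD {k : ℕ} {σ : FormField E M k} (hσ : IsSmooth σ) : IsSmooth (extD σ) := by
  intro x₀
  refine ContDiffOn.congr ?_ fun y hy => localRep_extD hσ x₀ hy
  have h1 : ContDiffOn ℝ ∞ (fderiv ℝ (localRep σ (chartAt E x₀))) (chartAt E x₀).target :=
    (hσ x₀).fderiv_of_isOpen (chartAt E x₀).open_target (by simp)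
  exact (ContinuousAlternatingMap.alternatizeUncurryFinCLM ℝ E ℝ).contDiff.comp_contDiffOn h1

theorem extD_extD {k : ℕ} {σ : FormField E M k} (hσ : IsSmooth σ) :
    DiffForm.extD (DiffForm.extD σ) = 0 := by
  refine formField_ext fun x => ?_
  have hy := mem_chart_target E x
  have hev : localRep (DiffForm.extD σ) (chartAt E x) =ᶠ[𝓝 (chartAt E x x)]
      extDeriv (localRep σ (chartAt E x)) := by
    filter_upwards [(chartAt E x).open_target.mem_nhds hy] with y hy'
    exact localRep_extD hσ x hy'
  have hr2 : minSmoothness ℝ 2 ≤ (∞ : WithTop ℕ∞) := by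
    rw [minSmoothness_of_isRCLikeNormedField]
    exact WithTop.coe_le_coe.2 (le_top : (2 : ℕ∞) ≤ ⊤)
  rw [evalAt_extD, hev.extDeriv_eq, extDeriv_extDeriv_apply (hσ.contDiffAt x hy) hr2]
  rfl

end ExteriorDerivative

/-! ### Cohomology classes and their representatives. -/

section CohomologyClasses

variable {E : Type*} [NormedAddCommGroup E] [NormedSpace ℝ E]
variable {M : Type*} [TopologicalSpace M] [ChartedSpace E M] [IsManifold 𝓘(ℝ, E) ∞ M]
variable {E' : Type*} [NormedAddCommGroup E'] [NormedSpace ℝ E']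
variable {N : Type*} [TopologicalSpace N] [ChartedSpace E' N] [IsManifold 𝓘(ℝ, E') ∞ N]

theorem pullback_mem_closedForms {k : ℕ} {f : N → M} (hf : ContMDiff 𝓘(ℝ, E') 𝓘(ℝ, E) ∞ f)
    {σ : FormField E M k} (hσ : σ ∈ closedForms E M k) :
    (pullback f σ : FormField E' N k) ∈ closedForms E' N k :=
  ⟨hσ.1.pullback hf, by rw [extD_pullback hf hσ.1, hσ.2]; rfl⟩

omit [IsManifold 𝓘(ℝ, E) ∞ M] in
theorem cohomClass_eq_iff {k : ℕ} (σ η : closedForms E M (k + 1)) :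
    cohomClass σ = cohomClass η ↔
      ∃ α : FormField E M k, IsSmooth α ∧ extD α = (σ : FormField E M (k + 1)) - η :=
  Submodule.Quotient.eq _

theorem cohomPullback_cohomClass {k : ℕ} (f : C^∞⟮𝓘(ℝ, E'), N; 𝓘(ℝ, E), M⟯)
    (σ : closedForms E M k) :
    cohomPullback f (cohomClass σ) =
      cohomClass ⟨pullback f (σ : FormField E M k), pullback_mem_closedForms f.contMDiff σ.2⟩ :=
  rfl

omit [IsManifold 𝓘(ℝ, E) ∞ M] in
theorem exists_cohomClass_eq {k : ℕ} (u : DeRham E M k) : ∃ σ, cohomClass σ = u :=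
  Submodule.Quotient.mk_surjective _ u

end CohomologyClasses

/-! ### Parametrizing a neighbourhood in the base by a whole vector space. -/

section Fibration

variable {EM : Type*} [NormedAddCommGroup EM] [NormedSpace ℝ EM]
variable {EB : Type*} [NormedAddCommGroup EB] [NormedSpace ℝ EB]
variable {EF : Type*} [NormedAddCommGroup EF] [NormedSpace ℝ EF]
variable {M : Type*} [TopologicalSpace M] [ChartedSpace EM M]
variable {B : Type*} [TopologicalSpace B] [ChartedSpace EB B]
variable {F : Type*} [TopologicalSpace F] [ChartedSpace EF F]
variable {p : M → B} {ω₀ : FormField EF F 2} (P : SymplecticFibration EM EB p ω₀)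
  {e : Bundle.Trivialization F p} (he : e ∈ P.atlas)

theorem SymplecticFibration.proj_fibreIncl {b : B} (hb : b ∈ e.baseSet) (f : F) :
    p (P.fibreIncl he hb f) = b := e.proj_symm_apply' hb

/-- A smooth map `EB → B`, with values in the base of a trivialization, that inverts a translate of
the chart around `b₀` near the origin. -/
theorem exists_smooth_parametrization [FiniteDimensional ℝ EB] [IsManifold 𝓘(ℝ, EB) ∞ B]
    (b₀ : B) {V : Set B} (hV : IsOpen V) (hb₀ : b₀ ∈ V) :
    ∃ (θ : EB → B) (U : Set B), ContMDiff 𝓘(ℝ, EB) 𝓘(ℝ, EB) ∞ θ ∧ (∀ y, θ y ∈ V) ∧ θ 0 = b₀ ∧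
      IsOpen U ∧ b₀ ∈ U ∧ U ⊆ V ∧ U ⊆ (chartAt EB b₀).source ∧
      ∀ b ∈ U, θ (chartAt EB b₀ b - chartAt EB b₀ b₀) = b := by
  set φ := chartAt EB b₀
  set y₀ := φ b₀
  have hW : φ.target ∩ φ.symm ⁻¹' V ∈ 𝓝 y₀ := by
    refine (φ.isOpen_inter_preimage_symm hV).mem_nhds ⟨mem_chart_target EB b₀, ?_⟩
    rwa [mem_preimage, φ.left_inv (mem_chart_source EB b₀)]
  obtain ⟨r, hr, hball⟩ := Metric.mem_nhds_iff.1 hW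
  let χ : ContDiffBump (0 : EB) := ⟨r / 2, r, by positivity, by linarith⟩
  have hχ : ContDiff ℝ ∞ χ := χ.contDiff
  -- The cut-off keeps `χ y • y` inside the ball of radius `r` for every `y`, while `ψ` remains the
  -- translation by `y₀` on the ball of radius `r / 2`.
  let ψ : EB → EB := fun y => y₀ + χ y • y
  have hψ : ContDiff ℝ ∞ ψ := contDiff_const.add (hχ.smul contDiff_id)
  have hψW : ∀ y, ψ y ∈ φ.target ∩ φ.symm ⁻¹' V := fun y => hball <| by
    rw [Metric.mem_ball, dist_eq_norm, add_sub_cancel_left, norm_smul, Real.norm_eq_abs,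
      abs_of_nonneg χ.nonneg]
    by_cases hy : ‖y‖ < r
    · exact (mul_le_of_le_one_left (norm_nonneg y) χ.le_one).trans_lt hy
    · rw [χ.zero_of_le_dist (by simpa using not_lt.1 hy), zero_mul]
      exact hr
  have hψ1 : ∀ y, ‖y‖ ≤ r / 2 → ψ y = y₀ + y := fun y hy => by
    change y₀ + χ y • y = _
    rw [χ.one_of_mem_closedBall (by simpa using hy), one_smul]
  refine ⟨φ.symm ∘ ψ, φ.source ∩ φ ⁻¹' (Metric.ball y₀ (r / 2)), ?_, fun y => (hψW y).2, ?_,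
    φ.isOpen_inter_preimage Metric.isOpen_ball, ⟨mem_chart_source EB b₀, ?_⟩, ?_,
    inter_subset_left, ?_⟩
  · exact (contMDiffOn_chart_symm (I := 𝓘(ℝ, EB)) (x := b₀)).comp_contMDiff hψ.contMDiff
      fun y => (hψW y).1
  · rw [Function.comp_apply, hψ1 0 (by simpa using (half_pos hr).le), add_zero]
    exact φ.left_inv (mem_chart_source EB b₀)
  · exact Metric.mem_ball_self (half_pos hr)
  · rintro b ⟨hb1, hb2⟩
    have h := (hball (Metric.ball_subset_ball (by linarith) hb2)).2
    rwa [mem_preimage, φ.left_inv hb1] at h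
  · rintro b ⟨hb1, hb2⟩
    rw [mem_preimage, Metric.mem_ball, dist_eq_norm] at hb2
    rw [Function.comp_apply, hψ1 _ hb2.le, add_sub_cancel]
    exact φ.left_inv hb1

end Fibration

/-! ### Smooth families of fibrewise primitives near one fibre. -/

section LocalPrimitive

variable {EM : Type*} [NormedAddCommGroup EM] [NormedSpace ℝ EM]
variable {EB : Type*} [NormedAddCommGroup EB] [NormedSpace ℝ EB] [FiniteDimensional ℝ EB]
variable {EF : Type*} [NormedAddCommGroup EF] [NormedSpace ℝ EF]
variable {M : Type*} [TopologicalSpace M] [ChartedSpace EM M] [IsManifold 𝓘(ℝ, EM) ∞ M]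
variable {B : Type*} [TopologicalSpace B] [ChartedSpace EB B] [IsManifold 𝓘(ℝ, EB) ∞ B]
variable {F : Type*} [TopologicalSpace F] [ChartedSpace EF F] [IsManifold 𝓘(ℝ, EF) ∞ F]
variable {p : M → B} {ω₀ : FormField EF F 2} (P : SymplecticFibration EM EB p ω₀)

/-- The primitive `α` on one fibre is propagated to its neighbours by the vertical homotopy. The
cut-off `ρ` is part of the statement so that the local form extends by zero to `M`. The conclusion
holds in every trivialization because transition maps preserve `ω₀`. -/
theorem SymplecticFibration.exists_local_primitive
    (hp : ContMDiff 𝓘(ℝ, EM) 𝓘(ℝ, EB) ∞ p)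
    {σ₀ : FormField EM M 2} (hσ₀ : σ₀ ∈ closedForms EM M 2)
    {e : Bundle.Trivialization F p} (he : e ∈ P.atlas) {b₀ : B} (hb₀ : b₀ ∈ e.baseSet)
    {α : FormField EF F 1} (hα : IsSmooth α)
    (hdα : extD α = pullback (P.fibreIncl he hb₀) σ₀ - ω₀) :
    ∃ U : Set B, IsOpen U ∧ b₀ ∈ U ∧ ∀ ρ : B → ℝ, ContMDiff 𝓘(ℝ, EB) 𝓘(ℝ, ℝ) ∞ ρ →
      tsupport ρ ⊆ U → ∃ μ : FormField EM M 1, IsSmooth μ ∧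
        ∀ (e' : Bundle.Trivialization F p) (he' : e' ∈ P.atlas) (b : B) (hb : b ∈ e'.baseSet),
          (pullback (P.fibreIncl he' hb) (extD μ) : FormField EF F 2) =
            ρ b • (pullback (P.fibreIncl he' hb) σ₀ - ω₀) := by
  obtain ⟨θ, U, hθ, hθe, hθ0, hU, hb₀U, hUe, hUφ, hθU⟩ :=
    exists_smooth_parametrization (EB := EB) b₀ e.open_baseSet hb₀
  set φ := chartAt EB b₀
  let G : EB × F → M := fun q => e.toOpenPartialHomeomorph.symm (θ q.1, q.2)
  have hG : ContMDiff 𝓘(ℝ, EB × EF) 𝓘(ℝ, EM) ∞ G := by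
    refine contMDiff_prodSelf_dom ((P.smooth_symm e he).comp_contMDiff
      ((hθ.comp contMDiff_fst).prodMk contMDiff_snd) fun q => ?_)
    exact e.mem_target.2 (hθe q.1)
  let η : FormField (EB × EF) (EB × F) 2 := pullback G σ₀
  have hη : η ∈ closedForms (EB × EF) (EB × F) 2 := pullback_mem_closedForms hG hσ₀
  have hj : ∀ y : EB, ContMDiff 𝓘(ℝ, EF) 𝓘(ℝ, EB × EF) ∞ (fun f : F => (y, f)) :=
    contMDiff_prodSelf_mk
  have hjη : ∀ y : EB, (pullback (fun f : F => (y, f)) η : FormField EF F 2) =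
      pullback (fun f : F => G (y, f)) σ₀ := fun y =>
    (pullback_comp (g := G) (f := fun f : F => (y, f))
      (fun x => (hG _).mdifferentiableAt (by simp))
      (fun x => (hj y x).mdifferentiableAt (by simp)) σ₀).symm
  -- The two fibrewise differentials telescope: the restriction of `σ₀` to the fibre over `θ y`
  -- minus that over `b₀`, plus the latter minus `ω₀`.
  let Λ : FormField (EB × EF) (EB × F) 1 := vertHomotopy η + pullback Prod.snd α
  have hsα : IsSmooth (pullback Prod.snd α : FormField (EB × EF) (EB × F) 1) :=
    hα.pullback contMDiff_prodSelf_snd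
  have hΛ : IsSmooth Λ := hη.1.vertHomotopy.add hsα
  have hdΛ : ∀ y : EB, (pullback (fun f : F => (y, f)) (extD Λ) : FormField EF F 2) =
      pullback (fun f : F => G (y, f)) σ₀ - ω₀ := fun y => by
    have h1 : (pullback (fun f : F => (y, f)) (pullback Prod.snd (extD α) :
        FormField (EB × EF) (EB × F) 2) : FormField EF F 2) = extD α := by
      rw [← pullback_comp (g := (Prod.snd : EB × F → F))
        (fun x => (contMDiff_prodSelf_snd _).mdifferentiableAt (by simp))
        (fun x => (hj y x).mdifferentiableAt (by simp))]
      refine formField_ext fun f => ?_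
      rw [evalAt_pullback]
      change (evalAt (extD α) f).compContinuousLinearMap (tmap EF EF (id : F → F) f) = _
      rw [tmap_id, compContinuousLinearMap_id']
    have h2 : (fun f : F => G (0, f)) = P.fibreIncl he hb₀ := by
      funext f
      change e.toOpenPartialHomeomorph.symm (θ 0, f) = _
      rw [hθ0]
      rfl
    rw [extD_add hη.1.vertHomotopy hsα, pullback_add, pullback_extD_vertHomotopy hη,
      extD_pullback contMDiff_prodSelf_snd hα, h1, hjη, hjη, hdα, h2]
    abel
  -- Over `U` this is a right inverse of `G`, that is `G (Q x) = x`.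
  let Q : M → EB × F := fun x => (φ (p x) - φ b₀, (e x).2)
  have hO : IsOpen (p ⁻¹' U) := hU.preimage hp.continuous
  have hOe : p ⁻¹' U ⊆ e.source := fun x hx => e.mem_source.2 (hUe hx)
  have he2 : ContMDiffOn 𝓘(ℝ, EM) 𝓘(ℝ, EF) ∞ (fun x => (e x).2) e.source :=
    contMDiff_snd.comp_contMDiffOn (P.smooth e he)
  have hQ : ContMDiffOn 𝓘(ℝ, EM) 𝓘(ℝ, EB × EF) ∞ Q (p ⁻¹' U) := by
    refine contMDiffOn_prodSelf_cod (ContMDiffOn.prodMk ?_ (he2.mono hOe))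
    have h1 : ContMDiffOn 𝓘(ℝ, EM) 𝓘(ℝ, EB) ∞ (φ ∘ p) (p ⁻¹' U) :=
      (contMDiffOn_chart (I := 𝓘(ℝ, EB)) (x := b₀)).comp hp.contMDiffOn fun x hx => hUφ hx
    have h2 : ContDiff ℝ ∞ fun y : EB => y - φ b₀ := contDiff_id.sub contDiff_const
    exact h2.contMDiff.comp_contMDiffOn h1
  refine ⟨U, hU, hb₀U, fun ρ hρ hsupp => ?_⟩
  have hρp : tsupport (ρ ∘ p) ⊆ p ⁻¹' U :=
    (tsupport_comp_subset_preimage ρ hp.continuous).trans (preimage_mono hsupp)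
  have hμ : IsSmooth (fmul (ρ ∘ p) (pullback Q Λ : FormField EM M 1)) :=
    isSmooth_fmul_pullback hO hQ hΛ (hρ.comp hp) hρp
  refine ⟨fmul (ρ ∘ p) (pullback Q Λ), hμ, fun e' he' b hb => ?_⟩
  set i := P.fibreIncl he' hb
  have hpi : ∀ f, p (i f) = b := P.proj_fibreIncl he' hb
  rw [← extD_pullback i.contMDiff hμ]
  -- `ρ ∘ p` is constant on a fibre, so after restriction it is a scalar that commutes with `extD`.
  have hmul : (pullback i (fmul (ρ ∘ p) (pullback Q Λ : FormField EM M 1)) : FormField EF F 1) =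
      ρ b • pullback i (pullback Q Λ : FormField EM M 1) := formField_ext fun f => by
    rw [evalAt_pullback, evalAt_fmul, Function.comp_apply, hpi]
    rfl
  rw [hmul, extD_smul]
  by_cases hbU : b ∈ U
  swap
  · rw [image_eq_zero_of_notMem_tsupport fun h => hbU (hsupp h), zero_smul, zero_smul]
  congr 1
  have hiU : ∀ f, i f ∈ p ⁻¹' U := fun f => by rwa [mem_preimage, hpi]
  -- On this fibre the inclusion through `e'` factors as the inclusion through `e` after `g`, and
  -- `g` preserves `ω₀`.
  let g : F → F := e'.coordChange e b
  have hg_eq : g = fun f => (e (i f)).2 := rfl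
  have hg : ContMDiff 𝓘(ℝ, EF) 𝓘(ℝ, EF) ∞ g := by
    rw [hg_eq]
    exact he2.comp_contMDiff i.contMDiff fun f => hOe (hiU f)
  set y := φ b - φ b₀
  have hQi : (Q : M → EB × F) ∘ i = (fun f : F => (y, f)) ∘ g := by
    funext f
    change (φ (p (i f)) - φ b₀, (e (i f)).2) = (φ b - φ b₀, g f)
    rw [hpi]
    rfl
  have hGg : (fun f : F => G (y, f)) ∘ g = i := by
    funext f
    change e.toOpenPartialHomeomorph.symm (θ y, (e (i f)).2) = i f
    rw [hθU b hbU, ← hpi f]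
    exact e.symm_apply_mk_proj (hOe (hiU f))
  have hgd : ∀ f, MDifferentiableAt 𝓘(ℝ, EF) 𝓘(ℝ, EF) g f := fun f =>
    (hg f).mdifferentiableAt (by simp)
  have h1 : (pullback i (pullback Q Λ : FormField EM M 1) : FormField EF F 1) =
      pullback g (pullback (fun f : F => (y, f)) Λ : FormField EF F 1) := by
    rw [← pullback_comp (fun f => (hQ.contMDiffAt (hO.mem_nhds (hiU f))).mdifferentiableAt
        (by simp)) (fun f => (i.contMDiff f).mdifferentiableAt (by simp)), hQi,
      pullback_comp (fun f => (hj y _).mdifferentiableAt (by simp)) hgd]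
  have h2 : (pullback g (pullback (fun f : F => G (y, f)) σ₀ : FormField EF F 2) :
      FormField EF F 2) = pullback i σ₀ := by
    have hGy : ContMDiff 𝓘(ℝ, EF) 𝓘(ℝ, EM) ∞ fun f : F => G (y, f) := hG.comp (hj y)
    rw [← pullback_comp (fun f => (hGy _).mdifferentiableAt (by simp)) hgd, hGg]
  have h3 : (pullback g ω₀ : FormField EF F 2) = ω₀ := P.symplectic e' he' e he b ⟨hb, hUe hbU⟩
  rw [h1, extD_pullback hg (hΛ.pullback (hj y)), extD_pullback (hj y) hΛ, hdΛ, pullback_sub, h2, h3]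

end LocalPrimitive

/-! ### Gluing the local primitives by a partition of unity on the base. -/

section Patching

variable {EM : Type*} [NormedAddCommGroup EM] [NormedSpace ℝ EM]
variable {EB : Type*} [NormedAddCommGroup EB] [NormedSpace ℝ EB] [FiniteDimensional ℝ EB]
variable {EF : Type*} [NormedAddCommGroup EF] [NormedSpace ℝ EF]
variable {M : Type*} [TopologicalSpace M] [ChartedSpace EM M] [IsManifold 𝓘(ℝ, EM) ∞ M]
variable {B : Type*} [TopologicalSpace B] [T2Space B] [CompactSpace B] [ChartedSpace EB B]
  [IsManifold 𝓘(ℝ, EB) ∞ B]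
variable {F : Type*} [TopologicalSpace F] [ChartedSpace EF F] [IsManifold 𝓘(ℝ, EF) ∞ F]
variable {p : M → B} {ω₀ : FormField EF F 2} (P : SymplecticFibration EM EB p ω₀)

/-- The glued forms have fibrewise differentials `ρ i b • (σ₀ - ω₀)`. Their sum is `σ₀ - ω₀` because
the weights add up to 1, and subtracting it leaves `ω₀`. -/
theorem SymplecticFibration.exists_primitive_correction
    (hp : ContMDiff 𝓘(ℝ, EM) 𝓘(ℝ, EB) ∞ p)
    {σ₀ : FormField EM M 2} (hσ₀ : σ₀ ∈ closedForms EM M 2)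
    (hex : ∀ (e : Bundle.Trivialization F p) (he : e ∈ P.atlas) (b : B) (hb : b ∈ e.baseSet),
      ∃ α : FormField EF F 1, IsSmooth α ∧ extD α = pullback (P.fibreIncl he hb) σ₀ - ω₀) :
    ∃ μ : FormField EM M 1, IsSmooth μ ∧
      ∀ (e : Bundle.Trivialization F p) (he : e ∈ P.atlas) (b : B) (hb : b ∈ e.baseSet),
        (pullback (P.fibreIncl he hb) (σ₀ - extD μ) : FormField EF F 2) = ω₀ := by
  have hloc : ∀ b₀ : B, ∃ U : Set B, IsOpen U ∧ b₀ ∈ U ∧ ∀ ρ : B → ℝ,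
      ContMDiff 𝓘(ℝ, EB) 𝓘(ℝ, ℝ) ∞ ρ → tsupport ρ ⊆ U → ∃ μ : FormField EM M 1, IsSmooth μ ∧
        ∀ (e' : Bundle.Trivialization F p) (he' : e' ∈ P.atlas) (b : B) (hb : b ∈ e'.baseSet),
          (pullback (P.fibreIncl he' hb) (extD μ) : FormField EF F 2) =
            ρ b • (pullback (P.fibreIncl he' hb) σ₀ - ω₀) := fun b₀ => by
    obtain ⟨e, he, hb₀⟩ := P.cover b₀
    obtain ⟨α, hα, hdα⟩ := hex e he b₀ hb₀
    exact P.exists_local_primitive hp hσ₀ he hb₀ hα hdα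
  choose U hU hmem hprim using hloc
  obtain ⟨t, ht⟩ := CompactSpace.elim_nhds_subcover U fun b => (hU b).mem_nhds (hmem b)
  obtain ⟨ρ, hρ⟩ := SmoothPartitionOfUnity.exists_isSubordinate 𝓘(ℝ, EB) isClosed_univ
    (fun i : t => U i) (fun i => hU i) (by rw [← top_eq_univ, ← ht, iUnion_subtype])
  have hfin : ∀ s : Finset t, ∃ μ : FormField EM M 1, IsSmooth μ ∧
      ∀ (e' : Bundle.Trivialization F p) (he' : e' ∈ P.atlas) (b : B) (hb : b ∈ e'.baseSet),
        (pullback (P.fibreIncl he' hb) (extD μ) : FormField EF F 2) =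
          (∑ i ∈ s, ρ i b) • (pullback (P.fibreIncl he' hb) σ₀ - ω₀) := by
    classical
    intro s
    induction s using Finset.induction_on with
    | empty =>
      refine ⟨0, isSmooth_zero, fun e' he' b hb => ?_⟩
      rw [extD_zero, Finset.sum_empty, zero_smul]
      rfl
    | insert i s his ih =>
      obtain ⟨μ, hμ, hμ'⟩ := ih
      obtain ⟨μi, hμi, hμi'⟩ := hprim i (ρ i) (ρ i).contMDiff (hρ i)
      refine ⟨μi + μ, hμi.add hμ, fun e' he' b hb => ?_⟩
      rw [extD_add hμi hμ, pullback_add, hμ', hμi', Finset.sum_insert his, add_smul]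
  obtain ⟨μ, hμ, hμ'⟩ := hfin Finset.univ
  refine ⟨μ, hμ, fun e he b hb => ?_⟩
  have hsum : ∑ i, ρ i b = 1 := by
    rw [← finsum_eq_sum_of_fintype]
    exact ρ.sum_eq_one (mem_univ b)
  rw [pullback_sub, hμ', hsum, one_smul, sub_sub_cancel]

end Patching

/-! ### Linear algebra of kernels of 2-forms. -/

section Kernels

variable {E : Type*} [NormedAddCommGroup E] [NormedSpace ℝ E] [FiniteDimensional ℝ E]

/-- An alternating 2-form on an odd-dimensional space is degenerate. -/
theorem exists_ne_zero_forall_apply_eq_zero_of_odd (hE : Odd (Module.finrank ℝ E))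
    (α : E [⋀^Fin 2]→L[ℝ] ℝ) : ∃ v : E, v ≠ 0 ∧ ∀ w, α ![v, w] = 0 := by
  let b := Module.finBasis ℝ E
  -- The indices are swapped so that `A.mulVec v` lists the values of `α` on the pairs `(∑ v j • b
  -- j, b i)`.
  let A : Matrix (Fin (Module.finrank ℝ E)) (Fin (Module.finrank ℝ E)) ℝ :=
    Matrix.of fun i j => α ![b j, b i]
  have hskew : ∀ v w, α ![v, w] = -α ![w, v] := fun v w => by
    have h := α.toAlternatingMap.map_swap ![w, v] (i := 0) (j := 1) (by decide)
    have hs : (![w, v] ∘ Equiv.swap (0 : Fin 2) 1) = ![v, w] := by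
      funext i; fin_cases i <;> simp
    rw [hs] at h
    exact h
  have hA : A.transpose = -A := by
    ext i j
    exact hskew _ _
  have hdet : A.det = 0 := by
    -- In odd size, `det A = det Aᵀ = det (-A) = -det A`.
    have h := A.det_transpose
    rw [hA, Matrix.det_neg, Fintype.card_fin, hE.neg_one_pow] at h
    linarith
  obtain ⟨v, hv, hAv⟩ := Matrix.exists_mulVec_eq_zero_iff.2 hdet
  refine ⟨∑ j, v j • b j, fun h => hv ?_, fun w => ?_⟩
  · exact funext fun j => Fintype.linearIndependent_iff.1 b.linearIndependent v h j
  · have h1 : ∀ i, α ![∑ j, v j • b j, b i] = 0 := fun i => by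
      have h2 := congrFun hAv i
      rw [Matrix.mulVec, dotProduct] at h2
      change ((α.curryLeft (∑ j, v j • b j)) ![b i] : ℝ) = 0
      rw [map_sum, ContinuousAlternatingMap.sum_apply]
      refine Eq.trans ?_ h2
      refine Finset.sum_congr rfl fun j _ => ?_
      rw [map_smul, ContinuousAlternatingMap.smul_apply, smul_eq_mul, mul_comm]
      rfl
    rw [hskew, neg_eq_zero]
    have h3 : α.curryLeft w ![∑ j, v j • b j] = 0 := by
      rw [← b.sum_repr w, map_sum, ContinuousAlternatingMap.sum_apply]
      refine Finset.sum_eq_zero fun i _ => ?_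
      rw [map_smul, ContinuousAlternatingMap.smul_apply]
      have h4 : α.curryLeft (b i) ![∑ j, v j • b j] = 0 := (hskew _ _).trans (by rw [h1, neg_zero])
      rw [h4, smul_zero]
    exact h3

theorem even_finrank_of_nondegenerate (α : E [⋀^Fin 2]→L[ℝ] ℝ)
    (h : ∀ v : E, (∀ w, α ![v, w] = 0) → v = 0) : Even (Module.finrank ℝ E) := by
  by_contra hE
  obtain ⟨v, hv, hv'⟩ :=
    exists_ne_zero_forall_apply_eq_zero_of_odd (Nat.not_even_iff_odd.1 hE) α
  exact hv (h v hv')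

variable {M : Type*} [TopologicalSpace M] [ChartedSpace E M]

omit [FiniteDimensional ℝ E] in
-- The functional `L` embeds the kernel in `ℝ`. In this form the rank condition becomes injectivity
-- of a linear map, which is stable under perturbation.
theorem finrank_kernelAt_le_one {σ : FormField E M 2} {x : M} (L : E →ₗ[ℝ] ℝ)
    (h : ∀ v : E, (∀ w, evalAt σ x ![v, w] = 0) → L v = 0 → v = 0) :
    Module.finrank ℝ (kernelAt σ x) ≤ 1 := by
  let K : Submodule ℝ E := kernelAt σ x
  have hinj : Function.Injective (L.comp K.subtype) := by
    refine (injective_iff_map_eq_zero _).2 fun v hv => ?_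
    exact Subtype.ext (h v v.2 hv)
  have h1 := LinearMap.finrank_le_finrank_of_injective hinj
  rwa [Module.finrank_self] at h1

/-- In odd dimension a 2-form is degenerate, so only the upper bound has to be established. -/
theorem finrank_kernelAt_eq_one {σ : FormField E M 2} {x : M} (hE : Odd (Module.finrank ℝ E))
    (h : Module.finrank ℝ (kernelAt σ x) ≤ 1) : Module.finrank ℝ (kernelAt σ x) = 1 := by
  let K : Submodule ℝ E := kernelAt σ x
  obtain ⟨v, hv, hv'⟩ := exists_ne_zero_forall_apply_eq_zero_of_odd hE (evalAt σ x)
  have hnt : Nontrivial K := ⟨⟨v, hv'⟩, 0, fun h0 => hv (congrArg Subtype.val h0)⟩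
  have hpos : 0 < Module.finrank ℝ K := Module.finrank_pos
  exact le_antisymm h hpos

omit [FiniteDimensional ℝ E] in
/-- A functional that does not vanish on the kernel of a presymplectic form. -/
theorem exists_functional_of_finrank_kernelAt_eq_one {σ : FormField E M 2} {x : M}
    (h : Module.finrank ℝ (kernelAt σ x) = 1) :
    ∃ l : E →L[ℝ] ℝ, ∀ v : E, (∀ w, evalAt σ x ![v, w] = 0) → l v = 0 → v = 0 := by
  let K : Submodule ℝ E := kernelAt σ x
  obtain ⟨k, hk, hspan⟩ := finrank_eq_one_iff'.1 (show Module.finrank ℝ K = 1 from h)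
  obtain ⟨l, hl⟩ := SeparatingDual.exists_eq_one (R := ℝ) (V := E) (x := k)
    fun h0 => hk (Subtype.ext h0)
  refine ⟨l, fun v hv hlv => ?_⟩
  obtain ⟨a, ha⟩ := hspan ⟨v, hv⟩
  have hav : a • (k : E) = v := congrArg Subtype.val ha
  have h1 := congrArg l hav
  rw [map_smul, hlv, hl, smul_eq_mul, mul_one] at h1
  rw [← hav, h1, zero_smul]

end Kernels

/-! ### Openness of the kernel condition under rescaling of the base directions. -/

section Deformation

variable {EB : Type*} [NormedAddCommGroup EB] [NormedSpace ℝ EB] [FiniteDimensional ℝ EB]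
variable {EF : Type*} [NormedAddCommGroup EF] [NormedSpace ℝ EF] [FiniteDimensional ℝ EF]

/-- The rescaling of the first factor by `ε`. -/
noncomputable def dilateFst (EB EF : Type*) [NormedAddCommGroup EB] [NormedSpace ℝ EB]
    [NormedAddCommGroup EF] [NormedSpace ℝ EF] (ε : ℝ) : EB × EF →L[ℝ] EB × EF :=
  (ε • ContinuousLinearMap.id ℝ EB).prodMap (ContinuousLinearMap.id ℝ EF)

/-- For `β` pulled back from the first factor and `α` non-degenerate on the second, the rescaled
sum of the forms is as non-degenerate as `β`, uniformly for nearby parameters. -/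
theorem eventually_dilate_nondegenerate {X : Type*} [TopologicalSpace X] {q₀ : X}
    {β : X → EB [⋀^Fin 2]→L[ℝ] ℝ} {α : X → (EB × EF) [⋀^Fin 2]→L[ℝ] ℝ}
    (hβ : ContinuousAt β q₀) (hα : ContinuousAt α q₀) (l : EB →L[ℝ] ℝ)
    (hl : ∀ v : EB, (∀ w, β q₀ ![v, w] = 0) → l v = 0 → v = 0)
    (hnd : ∀ v : EF, (∀ w : EF, α q₀ ![(0, v), (0, w)] = 0) → v = 0) :
    ∀ᶠ x : ℝ × X in 𝓝 (0, q₀), ∀ v : EB × EF,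
      (∀ w : EB × EF, β x.2 ![v.1, w.1] +
        α x.2 ![dilateFst EB EF x.1 v, dilateFst EB EF x.1 w] = 0) → l v.1 = 0 → v = 0 := by
  let D : ℝ × X → (EB × EF) [⋀^Fin 2]→L[ℝ] ℝ := fun x =>
    (β x.2).compContinuousLinearMap (ContinuousLinearMap.fst ℝ EB EF) +
      (α x.2).compContinuousLinearMap (dilateFst EB EF x.1)
  have hD_apply : ∀ x v w, D x ![v, w] = β x.2 ![v.1, w.1] +
      α x.2 ![dilateFst EB EF x.1 v, dilateFst EB EF x.1 w] := fun x v w => by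
    change β x.2 (fun i => (![v, w] i).1) + α x.2 (fun i => dilateFst EB EF x.1 (![v, w] i)) = _
    congr 2 <;> · funext i; fin_cases i <;> rfl
  have hS : Continuous (dilateFst EB EF) := by
    have h : dilateFst EB EF = fun ε : ℝ => ε • ((ContinuousLinearMap.inl ℝ EB EF).comp
        (ContinuousLinearMap.fst ℝ EB EF)) + (ContinuousLinearMap.inr ℝ EB EF).comp
        (ContinuousLinearMap.snd ℝ EB EF) := by
      funext ε
      ext v <;> simp [dilateFst]
    rw [h]
    fun_prop
  have hD : ContinuousAt D (0, q₀) := by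
    refine ContinuousAt.add ?_ ?_
    · exact ContinuousAt.comp (f := fun x : ℝ × X => (β x.2, ContinuousLinearMap.fst ℝ EB EF))
        (contDiff_compContinuousLinearMap (G := EB) (G' := EB × EF) (k := 2)).continuous.continuousAt
        ((hβ.comp_of_eq continuousAt_snd rfl).prodMk continuousAt_const)
    · exact ContinuousAt.comp (f := fun x : ℝ × X => (α x.2, dilateFst EB EF x.1))
        (contDiff_compContinuousLinearMap (G := EB × EF) (G' := EB × EF)
          (k := 2)).continuous.continuousAt
        ((hα.comp_of_eq continuousAt_snd rfl).prodMk (hS.continuousAt.comp continuousAt_fst))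
  -- Contraction with `D x` together with the functional `l`: the claim at `x` is the injectivity of
  -- `T x`, an open condition in finite dimension.
  let T : ℝ × X → (EB × EF) →L[ℝ] ((EB × EF) [⋀^Fin 1]→L[ℝ] ℝ) × ℝ := fun x =>
    (D x).curryLeft.prod (l.comp (ContinuousLinearMap.fst ℝ EB EF))
  have hT : ContinuousAt T (0, q₀) := by
    have h1 : ContinuousAt (fun x => ((D x).curryLeft :
        (EB × EF) →L[ℝ] (EB × EF) [⋀^Fin 1]→L[ℝ] ℝ)) (0, q₀) :=
      (contDiff_curryLeft (E := EB × EF)).continuous.continuousAt.comp hD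
    have h2 : T = fun x => (ContinuousLinearMap.inl ℝ ((EB × EF) [⋀^Fin 1]→L[ℝ] ℝ) ℝ).comp
        (D x).curryLeft + (ContinuousLinearMap.inr ℝ ((EB × EF) [⋀^Fin 1]→L[ℝ] ℝ) ℝ).comp
          (l.comp (ContinuousLinearMap.fst ℝ EB EF)) := by
      funext x
      refine ContinuousLinearMap.ext fun v => Prod.ext ?_ ?_
      · exact (add_zero _).symm
      · exact (zero_add _).symm
    rw [h2]
    exact (continuousAt_const.clm_comp h1).add continuousAt_const
  -- At `ε = 0` the dilation kills base directions, so `D` is the block sum of `β` and the vertical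
  -- part of `α`; testing on `(w, 0)` and `(0, w)` separates the blocks.
  have hT0 : Function.Injective (T (0, q₀)) := by
    refine (injective_iff_map_eq_zero _).2 fun v hv => ?_
    have hv1 : ∀ w, D (0, q₀) ![v, w] = 0 := fun w =>
      DFunLike.congr_fun (congrArg Prod.fst hv) ![w]
    have hv2 : l v.1 = 0 := congrArg Prod.snd hv
    have hdil : ∀ w : EB × EF, dilateFst EB EF 0 w = (0, w.2) := fun w => by
      exact Prod.ext (zero_smul ℝ w.1) rfl
    simp only [hD_apply, hdil] at hv1
    have h1 : v.1 = 0 := hl _ (fun w => by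
      have h := hv1 (w, 0)
      have h0 : α q₀ ![(0, v.2), (0, 0)] = 0 := (α q₀).map_coord_zero 1 rfl
      simpa [h0] using h) hv2
    have h2 : v.2 = 0 := hnd _ fun w => by
      have h := hv1 (0, w)
      have h0 : β q₀ ![v.1, 0] = 0 := (β q₀).map_coord_zero 1 rfl
      simpa [h0] using h
    exact Prod.ext h1 h2
  have hev := hT.eventually (ContinuousLinearMap.isOpen_injective.mem_nhds hT0)
  filter_upwards [hev] with x hx v hv hlv
  refine hx (?_ : T x v = T x 0)
  rw [map_zero]
  refine Prod.ext ?_ hlv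
  change (D x).curryLeft v = 0
  ext w
  have hw : w = ![w 0] := by funext i; fin_cases i; rfl
  rw [hw]
  exact (hD_apply x v (w 0)).trans (hv _)

end Deformation

/-! ### Coordinates on the total space adapted to the fibration. -/

section BundleCharts

variable {EM : Type*} [NormedAddCommGroup EM] [NormedSpace ℝ EM]
variable {EB : Type*} [NormedAddCommGroup EB] [NormedSpace ℝ EB]
variable {EF : Type*} [NormedAddCommGroup EF] [NormedSpace ℝ EF]
variable {M : Type*} [TopologicalSpace M] [ChartedSpace EM M]
variable {B : Type*} [TopologicalSpace B] [ChartedSpace EB B]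
variable {F : Type*} [TopologicalSpace F] [ChartedSpace EF F]
variable {p : M → B} {ω₀ : FormField EF F 2} (P : SymplecticFibration EM EB p ω₀)
  {e : Bundle.Trivialization F p} (he : e ∈ P.atlas)

/-- The domain of `bundleParam`. -/
def bundleParamSource (EB EF : Type*) [TopologicalSpace EB] [TopologicalSpace EF]
    [ChartedSpace EB B] [ChartedSpace EF F] (e : Bundle.Trivialization F p) (b₀ : B) (f₀ : F) :
    Set (EB × EF) :=
  ((chartAt EB b₀).target ∩ (chartAt EB b₀).symm ⁻¹' e.baseSet) ×ˢ (chartAt EF f₀).target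

/-- The local parametrization of the total space given by charts of the base and of the fibre. -/
noncomputable def bundleParam (EB EF : Type*) [TopologicalSpace EB] [TopologicalSpace EF]
    [ChartedSpace EB B] [ChartedSpace EF F] (e : Bundle.Trivialization F p) (b₀ : B) (f₀ : F) :
    EB × EF → M :=
  fun q => e.toOpenPartialHomeomorph.symm ((chartAt EB b₀).symm q.1, (chartAt EF f₀).symm q.2)

/-- The inverse of `bundleParam`. -/
noncomputable def bundleCoord (EB EF : Type*) [TopologicalSpace EB] [TopologicalSpace EF]
    [ChartedSpace EB B] [ChartedSpace EF F] (e : Bundle.Trivialization F p) (b₀ : B) (f₀ : F) :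
    M → EB × EF :=
  fun x => (chartAt EB b₀ (p x), chartAt EF f₀ (e x).2)

variable (b₀ : B) (f₀ : F)

omit [NormedSpace ℝ EB] [NormedSpace ℝ EF] in
theorem isOpen_bundleParamSource : IsOpen (bundleParamSource EB EF e b₀ f₀) :=
  ((chartAt EB b₀).isOpen_inter_preimage_symm e.open_baseSet).prod (chartAt EF f₀).open_target

variable {b₀ f₀}

omit [NormedSpace ℝ EB] [NormedSpace ℝ EF] in
theorem proj_bundleParam {q : EB × EF}
    (hq : q ∈ bundleParamSource EB EF e b₀ f₀) :
    p (bundleParam EB EF e b₀ f₀ q) = (chartAt EB b₀).symm q.1 :=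
  e.proj_symm_apply' hq.1.2

omit [NormedSpace ℝ EB] [NormedSpace ℝ EF] in
theorem bundleCoord_bundleParam {q : EB × EF} (hq : q ∈ bundleParamSource EB EF e b₀ f₀) :
    bundleCoord EB EF e b₀ f₀ (bundleParam EB EF e b₀ f₀ q) = q := by
  rw [bundleCoord, proj_bundleParam hq, (chartAt EB b₀).right_inv hq.1.1, bundleParam,
    e.apply_symm_apply' hq.1.2, (chartAt EF f₀).right_inv hq.2]

variable [IsManifold 𝓘(ℝ, EB) ∞ B] [IsManifold 𝓘(ℝ, EF) ∞ F]

include he in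
theorem contMDiffOn_bundleParam :
    ContMDiffOn 𝓘(ℝ, EB × EF) 𝓘(ℝ, EM) ∞ (bundleParam EB EF e b₀ f₀)
      (bundleParamSource EB EF e b₀ f₀) := by
  refine (P.smooth_symm e he).comp (ContMDiffOn.prodMk ?_ ?_) fun q hq => e.mem_target.2 hq.1.2
  · exact (contMDiffOn_chart_symm (I := 𝓘(ℝ, EB)) (x := b₀)).comp
      (contDiff_fst (E := EB) (F := EF)).contMDiff.contMDiffOn fun q hq => hq.1.1
  · exact (contMDiffOn_chart_symm (I := 𝓘(ℝ, EF)) (x := f₀)).comp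
      (contDiff_snd (E := EB) (F := EF)).contMDiff.contMDiffOn fun q hq => hq.2

include he in
theorem contMDiffAt_bundleCoord (hp : ContMDiff 𝓘(ℝ, EM) 𝓘(ℝ, EB) ∞ p) {x : M}
    (hx : p x ∈ e.baseSet) (hxb : p x ∈ (chartAt EB b₀).source)
    (hxf : (e x).2 ∈ (chartAt EF f₀).source) :
    ContMDiffAt 𝓘(ℝ, EM) 𝓘(ℝ, EB × EF) ∞ (bundleCoord EB EF e b₀ f₀) x := by
  have hxe : x ∈ e.source := e.mem_source.2 hx
  have he2 : ContMDiffAt 𝓘(ℝ, EM) 𝓘(ℝ, EF) ∞ (fun x => (e x).2) x :=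
    contMDiff_snd.contMDiffAt.comp x ((P.smooth e he).contMDiffAt (e.open_source.mem_nhds hxe))
  refine ContMDiffAt.prodMk_space ?_ ?_
  · exact (contMDiffAt_of_mem_maximalAtlas (IsManifold.chart_mem_maximalAtlas b₀) hxb).comp x (hp x)
  · exact ContMDiffAt.comp x
      (contMDiffAt_of_mem_maximalAtlas (IsManifold.chart_mem_maximalAtlas f₀) hxf) he2

include he in
/-- The differential of `bundleParam` is invertible. -/
theorem exists_tmap_bundleParam_equiv (hp : ContMDiff 𝓘(ℝ, EM) 𝓘(ℝ, EB) ∞ p) {q : EB × EF}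
    (hq : q ∈ bundleParamSource EB EF e b₀ f₀) :
    ∃ A : (EB × EF) ≃ₗ[ℝ] EM, ∀ v, A v = tmap (EB × EF) EM (bundleParam EB EF e b₀ f₀) q v := by
  set Θ := bundleParam EB EF e b₀ f₀
  set R := bundleCoord EB EF e b₀ f₀
  have hO := isOpen_bundleParamSource (EB := EB) (EF := EF) (e := e) b₀ f₀
  have hΘ : MDifferentiableAt 𝓘(ℝ, EB × EF) 𝓘(ℝ, EM) Θ q :=
    ((contMDiffOn_bundleParam P he).contMDiffAt (hO.mem_nhds hq)).mdifferentiableAt (by simp)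
  have hpx : p (Θ q) = (chartAt EB b₀).symm q.1 := proj_bundleParam hq
  have hex : (e (Θ q)).2 = (chartAt EF f₀).symm q.2 :=
    congrArg Prod.snd (e.apply_symm_apply' hq.1.2)
  have hbase : p (Θ q) ∈ e.baseSet := by rw [hpx]; exact hq.1.2
  have hbs : p (Θ q) ∈ (chartAt EB b₀).source := by
    rw [hpx]; exact (chartAt EB b₀).map_target hq.1.1
  have hfs : (e (Θ q)).2 ∈ (chartAt EF f₀).source := by
    rw [hex]; exact (chartAt EF f₀).map_target hq.2
  have hR : MDifferentiableAt 𝓘(ℝ, EM) 𝓘(ℝ, EB × EF) R (Θ q) :=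
    (contMDiffAt_bundleCoord P he hp hbase hbs hfs).mdifferentiableAt (by simp)
  have hRΘ : R (Θ q) = q := bundleCoord_bundleParam hq
  have h1 : (tmap EM (EB × EF) R (Θ q)).comp (tmap (EB × EF) EM Θ q) =
      ContinuousLinearMap.id ℝ (EB × EF) := by
    rw [← tmap_comp hR hΘ, ← tmap_id q]
    refine Filter.EventuallyEq.mfderiv_eq ?_
    filter_upwards [hO.mem_nhds hq] with q' hq'
    exact bundleCoord_bundleParam hq'
  have h2 : (tmap (EB × EF) EM Θ q).comp (tmap EM (EB × EF) R (Θ q)) =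
      ContinuousLinearMap.id ℝ EM := by
    have hΘ' : MDifferentiableAt 𝓘(ℝ, EB × EF) 𝓘(ℝ, EM) Θ (R (Θ q)) := by rwa [hRΘ]
    have h3 := tmap_comp hΘ' hR
    rw [hRΘ] at h3
    rw [← h3, ← tmap_id (Θ q)]
    refine Filter.EventuallyEq.mfderiv_eq ?_
    have hc1 : ∀ᶠ x in 𝓝 (Θ q), p x ∈ e.baseSet ∩ (chartAt EB b₀).source :=
      hp.continuous.continuousAt.eventually
        ((e.open_baseSet.inter (chartAt EB b₀).open_source).mem_nhds ⟨hbase, hbs⟩)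
    have hc2 : ContinuousAt (fun x => (e x).2) (Θ q) :=
      continuousAt_snd.comp ((P.smooth e he).continuousOn.continuousAt
        (e.open_source.mem_nhds (e.mem_source.2 hbase)))
    filter_upwards [hc1, hc2.eventually ((chartAt EF f₀).open_source.mem_nhds hfs)] with x hx1 hx2
    change e.toOpenPartialHomeomorph.symm ((chartAt EB b₀).symm (chartAt EB b₀ (p x)),
      (chartAt EF f₀).symm (chartAt EF f₀ (e x).2)) = x
    rw [(chartAt EB b₀).left_inv hx1.2, (chartAt EF f₀).left_inv hx2]
    exact e.symm_apply_mk_proj (e.mem_source.2 hx1.1)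
  exact ⟨LinearEquiv.ofLinearMap (tmap (EB × EF) EM Θ q : (EB × EF) →ₗ[ℝ] EM)
    (tmap EM (EB × EF) R (Θ q) : EM →ₗ[ℝ] (EB × EF))
    (LinearMap.ext fun v => DFunLike.congr_fun h2 v)
    (LinearMap.ext fun v => DFunLike.congr_fun h1 v), fun v => rfl⟩

include he in
-- In these coordinates `p` is the first projection, so a form pulled back from the base sees only
-- base directions.
theorem evalAt_pullback_proj_bundleParam (hp : ContMDiff 𝓘(ℝ, EM) 𝓘(ℝ, EB) ∞ p) {q : EB × EF}
    (hq : q ∈ bundleParamSource EB EF e b₀ f₀) {k : ℕ} (σ : FormField EB B k) :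
    (evalAt (pullback p σ : FormField EM M k)
      (bundleParam EB EF e b₀ f₀ q)).compContinuousLinearMap
        (tmap (EB × EF) EM (bundleParam EB EF e b₀ f₀) q) =
      (localRep σ (chartAt EB b₀) q.1).compContinuousLinearMap
        (ContinuousLinearMap.fst ℝ EB EF) := by
  have hO := isOpen_bundleParamSource (EB := EB) (EF := EF) (e := e) b₀ f₀
  have hΘ : MDifferentiableAt 𝓘(ℝ, EB × EF) 𝓘(ℝ, EM) (bundleParam EB EF e b₀ f₀) q :=
    ((contMDiffOn_bundleParam P he).contMDiffAt (hO.mem_nhds hq)).mdifferentiableAt (by simp)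
  have hpd : MDifferentiableAt 𝓘(ℝ, EM) 𝓘(ℝ, EB) p (bundleParam EB EF e b₀ f₀ q) :=
    (hp _).mdifferentiableAt (by simp)
  have hφ : MDifferentiableAt 𝓘(ℝ, EB) 𝓘(ℝ, EB) (chartAt EB b₀).symm q.1 :=
    mdifferentiableAt_atlas_symm (chart_mem_atlas EB b₀) hq.1.1
  have hfst : MDifferentiableAt 𝓘(ℝ, EB × EF) 𝓘(ℝ, EB) (Prod.fst : EB × EF → EB) q :=
    differentiableAt_fst.mdifferentiableAt
  have h1 : (tmap EM EB p (bundleParam EB EF e b₀ f₀ q)).comp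
      (tmap (EB × EF) EM (bundleParam EB EF e b₀ f₀) q) =
      (tmap EB EB (chartAt EB b₀).symm q.1).comp (ContinuousLinearMap.fst ℝ EB EF) := by
    have h2 : tmap (EB × EF) EB (Prod.fst : EB × EF → EB) q = ContinuousLinearMap.fst ℝ EB EF :=
      mfderiv_eq_fderiv.trans fderiv_fst
    rw [← tmap_comp hpd hΘ, ← h2, ← tmap_comp hφ hfst]
    refine Filter.EventuallyEq.mfderiv_eq ?_
    filter_upwards [hO.mem_nhds hq] with q' hq'
    exact proj_bundleParam hq'
  rw [evalAt_pullback, compContinuousLinearMap_comp, h1, proj_bundleParam hq, localRep_eq,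
    compContinuousLinearMap_comp]

/-- With the base coordinate frozen, `bundleParam` is the fibre inclusion composed with an inverse
chart of `F`; this identifies the vertical block of `τ` with the restriction to the fibre. -/
theorem evalAt_bundleParam_vertical {q : EB × EF} (hq : q ∈ bundleParamSource EB EF e b₀ f₀)
    {k : ℕ} (τ : FormField EM M k) {b : B} (hb : b ∈ e.baseSet)
    (hqb : (chartAt EB b₀).symm q.1 = b) :
    ((evalAt τ (bundleParam EB EF e b₀ f₀ q)).compContinuousLinearMap
        (tmap (EB × EF) EM (bundleParam EB EF e b₀ f₀) q)).compContinuousLinearMap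
          (ContinuousLinearMap.inr ℝ EB EF) =
      localRep (pullback (P.fibreIncl he hb) τ : FormField EF F k) (chartAt EF f₀) q.2 := by
  have hO := isOpen_bundleParamSource (EB := EB) (EF := EF) (e := e) b₀ f₀
  have hΘ : MDifferentiableAt 𝓘(ℝ, EB × EF) 𝓘(ℝ, EM) (bundleParam EB EF e b₀ f₀) (q.1, q.2) :=
    ((contMDiffOn_bundleParam P he).contMDiffAt (hO.mem_nhds hq)).mdifferentiableAt (by simp)
  have hj : MDifferentiableAt 𝓘(ℝ, EF) 𝓘(ℝ, EB × EF) (fun z : EF => (q.1, z)) q.2 :=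
    (hasFDerivAt_prodMk_right q.1 q.2).differentiableAt.mdifferentiableAt
  have hc : MDifferentiableAt 𝓘(ℝ, EF) 𝓘(ℝ, EF) (chartAt EF f₀).symm q.2 :=
    mdifferentiableAt_atlas_symm (chart_mem_atlas EF f₀) hq.2
  have hi : MDifferentiableAt 𝓘(ℝ, EF) 𝓘(ℝ, EM) (P.fibreIncl he hb) ((chartAt EF f₀).symm q.2) :=
    ((P.fibreIncl he hb).contMDiff _).mdifferentiableAt (by simp)
  have h1 : tmap EF (EB × EF) (fun z : EF => (q.1, z)) q.2 = ContinuousLinearMap.inr ℝ EB EF :=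
    mfderiv_eq_fderiv.trans (hasFDerivAt_prodMk_right q.1 q.2).fderiv
  have h2 : bundleParam EB EF e b₀ f₀ ∘ (fun z : EF => (q.1, z)) =
      P.fibreIncl he hb ∘ (chartAt EF f₀).symm := by
    funext z
    change e.toOpenPartialHomeomorph.symm ((chartAt EB b₀).symm q.1, _) = _
    rw [hqb]
    rfl
  have h3 := tmap_comp hΘ hj
  rw [h2, tmap_comp hi hc, h1] at h3
  have h4 : bundleParam EB EF e b₀ f₀ q = P.fibreIncl he hb ((chartAt EF f₀).symm q.2) :=
    congrFun h2 q.2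
  rw [compContinuousLinearMap_comp, localRep_eq, evalAt_pullback, compContinuousLinearMap_comp, h3,
    h4]

variable [IsManifold 𝓘(ℝ, EM) ∞ M]

include he in
theorem continuousAt_evalAt_bundleParam {q : EB × EF}
    (hq : q ∈ bundleParamSource EB EF e b₀ f₀) {k : ℕ} {τ : FormField EM M k} (hτ : IsSmooth τ) :
    ContinuousAt (fun q => (evalAt τ (bundleParam EB EF e b₀ f₀ q)).compContinuousLinearMap
      (tmap (EB × EF) EM (bundleParam EB EF e b₀ f₀) q)) q := by
  have h := (contDiffAt_localRep_pullback (isOpen_bundleParamSource b₀ f₀)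
    (contMDiffOn_bundleParam P he) hτ q (y := q) (mem_univ _) hq).continuousAt
  refine h.congr (Filter.Eventually.of_forall fun q' => ?_)
  change (evalAt τ (bundleParam EB EF e b₀ f₀ q')).compContinuousLinearMap
    ((tmap (EB × EF) EM (bundleParam EB EF e b₀ f₀) q').comp
      (tmap (EB × EF) (EB × EF) (id : EB × EF → EB × EF) q')) = _
  rw [tmap_id, ContinuousLinearMap.comp_id]

end BundleCharts

/-! ### Large multiples of the base form near one point of a fibre. -/

section LargeMultiples

variable {EM : Type*} [NormedAddCommGroup EM] [NormedSpace ℝ EM]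
variable {EB : Type*} [NormedAddCommGroup EB] [NormedSpace ℝ EB] [FiniteDimensional ℝ EB]
variable {EF : Type*} [NormedAddCommGroup EF] [NormedSpace ℝ EF] [FiniteDimensional ℝ EF]
variable {M : Type*} [TopologicalSpace M] [ChartedSpace EM M] [IsManifold 𝓘(ℝ, EM) ∞ M]
variable {B : Type*} [TopologicalSpace B] [ChartedSpace EB B] [IsManifold 𝓘(ℝ, EB) ∞ B]
variable {F : Type*} [TopologicalSpace F] [ChartedSpace EF F] [IsManifold 𝓘(ℝ, EF) ∞ F]
variable {p : M → B} {ω₀ : FormField EF F 2} (P : SymplecticFibration EM EB p ω₀)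
  {e : Bundle.Trivialization F p} (he : e ∈ P.atlas)

section ChartKernels

variable {E : Type*} [NormedAddCommGroup E] [NormedSpace ℝ E]
variable {N : Type*} [TopologicalSpace N] [ChartedSpace E N] [IsManifold 𝓘(ℝ, E) ∞ N]

/-- A vector in the kernel of the coordinate expression maps to the kernel of the form. -/
theorem evalAt_eq_zero_of_localRep_eq_zero {σ : FormField E N 2} (x₀ : N) {y : E}
    (hy : y ∈ (chartAt E x₀).target) {v : E}
    (hv : ∀ w, localRep σ (chartAt E x₀) y ![v, w] = 0) (w : E) :
    evalAt σ ((chartAt E x₀).symm y) ![tmap E E (chartAt E x₀).symm y v, w] = 0 := by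
  have h := hv (tmap E E (chartAt E x₀) ((chartAt E x₀).symm y) w)
  rw [localRep_eq, ContinuousAlternatingMap.compContinuousLinearMap_apply] at h
  rw [← h]
  congr 1
  funext i
  fin_cases i
  · rfl
  · exact (DFunLike.congr_fun (tmap_symm_chartAt_comp x₀ hy) w).symm

theorem tmap_chartAt_symm_injective (x₀ : N) {y : E} (hy : y ∈ (chartAt E x₀).target) {v : E}
    (hv : tmap E E (chartAt E x₀).symm y v = 0) : v = 0 := by
  have h := DFunLike.congr_fun (tmap_chartAt_comp_symm x₀ hy) v
  rw [ContinuousLinearMap.comp_apply, hv, map_zero] at h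
  exact h.symm

end ChartKernels

include he in
-- The multiple `ε⁻²` is chosen to cancel the `ε²` that `p^*ωB` acquires from the dilation. For `ε ≠
-- 0` the dilation is invertible and does not change the kernel dimension, while the rescaled form
-- has a limit at `ε = 0`, where the kernel can be computed.
theorem eventually_finrank_kernelAt_le_one_near (hp : ContMDiff 𝓘(ℝ, EM) 𝓘(ℝ, EB) ∞ p)
    (hω₀ : ∀ x, kernelAt ω₀ x = ⊥) {ωB : FormField EB B 2} (hsB : IsSmooth ωB)
    {τ : FormField EM M 2} (hτ : IsSmooth τ) {b₀ : B} (hb₀ : b₀ ∈ e.baseSet)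
    (hkB : Module.finrank ℝ (kernelAt ωB b₀) = 1)
    (hτF : (pullback (P.fibreIncl he hb₀) τ : FormField EF F 2) = ω₀) (f₀ : F) :
    ∀ᶠ x : (ℝ × B) × F in 𝓝 ((0, b₀), f₀), x.1.1 ≠ 0 →
      Module.finrank ℝ (kernelAt (τ + (x.1.1⁻¹ ^ 2) • (pullback p ωB : FormField EM M 2))
        (e.toOpenPartialHomeomorph.symm (x.1.2, x.2))) ≤ 1 := by
  set φ := chartAt EB b₀
  set c := chartAt EF f₀
  have hφb : φ.symm (φ b₀) = b₀ := φ.left_inv (mem_chart_source EB b₀)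
  have hcf : c.symm (c f₀) = f₀ := c.left_inv (mem_chart_source EF f₀)
  let q₀ : EB × EF := (φ b₀, c f₀)
  have hq₀ : q₀ ∈ bundleParamSource EB EF e b₀ f₀ := by
    refine ⟨⟨mem_chart_target EB b₀, ?_⟩, mem_chart_target EF f₀⟩
    change φ.symm (φ b₀) ∈ e.baseSet
    rwa [hφb]
  let α : EB × EF → (EB × EF) [⋀^Fin 2]→L[ℝ] ℝ := fun q =>
    (evalAt τ (bundleParam EB EF e b₀ f₀ q)).compContinuousLinearMap
      (tmap (EB × EF) EM (bundleParam EB EF e b₀ f₀) q)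
  let β : EB × EF → EB [⋀^Fin 2]→L[ℝ] ℝ := fun q => localRep ωB φ q.1
  have hα : ContinuousAt α q₀ := continuousAt_evalAt_bundleParam P he hq₀ hτ
  have hβ : ContinuousAt β q₀ :=
    ContinuousAt.comp (f := Prod.fst) (g := localRep ωB φ)
      (hsB.contDiffAt b₀ (mem_chart_target EB b₀)).continuousAt continuousAt_fst
  obtain ⟨l, hl⟩ := exists_functional_of_finrank_kernelAt_eq_one hkB
  have hl' : ∀ v : EB, (∀ w, β q₀ ![v, w] = 0) →
      (l.comp (tmap EB EB φ.symm (φ b₀))) v = 0 → v = 0 := fun v hv hlv => by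
    refine tmap_chartAt_symm_injective b₀ (mem_chart_target EB b₀) (hl _ (fun w => ?_) hlv)
    have h := evalAt_eq_zero_of_localRep_eq_zero b₀ (mem_chart_target EB b₀) hv w
    change evalAt ωB (φ.symm (φ b₀)) _ = 0 at h
    rwa [hφb] at h
  have hnd : ∀ v : EF, (∀ w : EF, α q₀ ![(0, v), (0, w)] = 0) → v = 0 := fun v hv => by
    have h1 := evalAt_bundleParam_vertical P he hq₀ τ hb₀ hφb
    rw [hτF] at h1
    have h2 : ∀ w, localRep ω₀ c (c f₀) ![v, w] = 0 := fun w => by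
      refine (DFunLike.congr_fun h1 ![v, w]).symm.trans ((congrArg (α q₀) ?_).trans (hv w))
      funext i
      fin_cases i <;> rfl
    have h3 := evalAt_eq_zero_of_localRep_eq_zero f₀ (mem_chart_target EF f₀) h2
    have h4 : tmap EF EF c.symm (c f₀) v ∈ (kernelAt ω₀ (c.symm (c f₀)) : Submodule ℝ EF) := h3
    have h5 : tmap EF EF c.symm (c f₀) v ∈ (⊥ : Submodule ℝ EF) := hω₀ (c.symm (c f₀)) ▸ h4
    exact tmap_chartAt_symm_injective f₀ (mem_chart_target EF f₀) h5
  have hev := eventually_dilate_nondegenerate hβ hα _ hl' hnd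
  have hlim : Filter.Tendsto (fun x : (ℝ × B) × F => (x.1.1, (φ x.1.2, c x.2)))
      (𝓝 ((0, b₀), f₀)) (𝓝 (0, q₀)) := by
    have h1 : ContinuousAt (fun x : (ℝ × B) × F => φ x.1.2) ((0, b₀), f₀) :=
      ContinuousAt.comp (f := fun x : (ℝ × B) × F => x.1.2)
        (φ.continuousAt (mem_chart_source EB b₀)) (by fun_prop)
    have h2 : ContinuousAt (fun x : (ℝ × B) × F => c x.2) ((0, b₀), f₀) :=
      ContinuousAt.comp (f := fun x : (ℝ × B) × F => x.2)
        (c.continuousAt (mem_chart_source EF f₀)) (by fun_prop)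
    exact (continuousAt_fst.fst.prodMk (h1.prodMk h2))
  have hbs : ∀ᶠ x : (ℝ × B) × F in 𝓝 ((0, b₀), f₀), x.1.2 ∈ φ.source ∩ e.baseSet :=
    (show ContinuousAt (fun x : (ℝ × B) × F => x.1.2) ((0, b₀), f₀) by fun_prop).eventually
      ((φ.open_source.inter e.open_baseSet).mem_nhds ⟨mem_chart_source EB b₀, hb₀⟩)
  have hfs : ∀ᶠ x : (ℝ × B) × F in 𝓝 ((0, b₀), f₀), x.2 ∈ c.source :=
    continuousAt_snd.eventually (c.open_source.mem_nhds (mem_chart_source EF f₀))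
  filter_upwards [hlim.eventually hev, hbs, hfs] with ⟨⟨ε, b⟩, f⟩ hnondeg hb hf hε
  simp only at hnondeg hb hf hε ⊢
  set q : EB × EF := (φ b, c f)
  have hq : q ∈ bundleParamSource EB EF e b₀ f₀ := by
    refine ⟨⟨φ.map_source hb.1, ?_⟩, c.map_source hf⟩
    change φ.symm (φ b) ∈ e.baseSet
    rw [φ.left_inv hb.1]
    exact hb.2
  have hx : e.toOpenPartialHomeomorph.symm (b, f) = bundleParam EB EF e b₀ f₀ q := by
    change _ = e.toOpenPartialHomeomorph.symm (φ.symm (φ b), c.symm (c f))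
    rw [φ.left_inv hb.1, c.left_inv hf]
  rw [hx]
  obtain ⟨A, hA⟩ := exists_tmap_bundleParam_equiv P he hp hq
  have hform : ∀ v w : EB × EF, evalAt (τ + (ε⁻¹ ^ 2) • (pullback p ωB : FormField EM M 2))
      (bundleParam EB EF e b₀ f₀ q) ![A (dilateFst EB EF ε v), A (dilateFst EB EF ε w)] =
      β q ![v.1, w.1] + α q ![dilateFst EB EF ε v, dilateFst EB EF ε w] := fun v w => by
    have hvec : ∀ γ : EM [⋀^Fin 2]→L[ℝ] ℝ,
        γ ![A (dilateFst EB EF ε v), A (dilateFst EB EF ε w)] =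
          (γ.compContinuousLinearMap (tmap (EB × EF) EM (bundleParam EB EF e b₀ f₀) q))
            ![dilateFst EB EF ε v, dilateFst EB EF ε w] := fun γ =>
      congrArg γ (funext fun i => by fin_cases i <;> exact hA _)
    rw [evalAt_add, evalAt_smul, ContinuousAlternatingMap.add_apply,
      ContinuousAlternatingMap.smul_apply, hvec, hvec, evalAt_pullback_proj_bundleParam P he hp hq,
      add_comm]
    congr 1
    have h2 : ((localRep ωB φ q.1).compContinuousLinearMap (ContinuousLinearMap.fst ℝ EB EF))
        ![dilateFst EB EF ε v, dilateFst EB EF ε w] = ε ^ 2 * β q ![v.1, w.1] := by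
      have h3 : β q ![ε • v.1, ε • w.1] = ε ^ 2 * β q ![v.1, w.1] := by
        have h4 := (β q).map_smul_univ (fun _ : Fin 2 => ε) ![v.1, w.1]
        simp only [Finset.prod_const, Finset.card_univ, Fintype.card_fin, smul_eq_mul] at h4
        rw [← h4]
        congr 1
        funext i
        fin_cases i <;> rfl
      rw [← h3]
      refine congrArg (β q) (funext fun i => ?_)
      fin_cases i <;> rfl
    rw [h2, smul_eq_mul, ← mul_assoc, ← mul_pow, inv_mul_cancel₀ hε, one_pow, one_mul]
  have hdil : ∀ v : EB × EF, dilateFst EB EF ε (dilateFst EB EF ε⁻¹ v) = v := fun v =>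
    Prod.ext (smul_inv_smul₀ hε v.1) rfl
  -- The functional is read in rescaled coordinates: `v` is first written as `A (S_ε w)`, and the
  -- base functional is then applied to `w.1`.
  let L : EM →ₗ[ℝ] ℝ := ((l.comp (tmap EB EB φ.symm (φ b₀))).comp
    ((ContinuousLinearMap.fst ℝ EB EF).comp (dilateFst EB EF ε⁻¹))).toLinearMap.comp
      A.symm.toLinearMap
  refine finrank_kernelAt_le_one L fun v hv hLv => ?_
  have hv' : A (dilateFst EB EF ε (dilateFst EB EF ε⁻¹ (A.symm v))) = v := by
    rw [hdil, A.apply_symm_apply]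
  have h0 : dilateFst EB EF ε⁻¹ (A.symm v) = 0 := hnondeg _ (fun w => by
    rw [← hform, hv']
    exact hv _) hLv
  rw [← hv', h0, map_zero, map_zero]

end LargeMultiples

/-! ### One multiple that works on the whole total space. -/

section GlobalRank

variable {EM : Type*} [NormedAddCommGroup EM] [NormedSpace ℝ EM]
variable {EB : Type*} [NormedAddCommGroup EB] [NormedSpace ℝ EB] [FiniteDimensional ℝ EB]
variable {EF : Type*} [NormedAddCommGroup EF] [NormedSpace ℝ EF] [FiniteDimensional ℝ EF]
variable {M : Type*} [TopologicalSpace M] [ChartedSpace EM M] [IsManifold 𝓘(ℝ, EM) ∞ M]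
variable {B : Type*} [TopologicalSpace B] [CompactSpace B] [ChartedSpace EB B]
  [IsManifold 𝓘(ℝ, EB) ∞ B]
variable {F : Type*} [TopologicalSpace F] [CompactSpace F] [ChartedSpace EF F]
  [IsManifold 𝓘(ℝ, EF) ∞ F]
variable {p : M → B} {ω₀ : FormField EF F 2} (P : SymplecticFibration EM EB p ω₀)

/-- The tube lemma is applied twice, over the compact fibre and then over the compact base, so that
one neighbourhood of `ε = 0` serves all points; any positive `ε` in it gives `K = ε⁻²`. -/
theorem SymplecticFibration.exists_pos_finrank_kernelAt_le_one
    (hp : ContMDiff 𝓘(ℝ, EM) 𝓘(ℝ, EB) ∞ p) (hω₀ : ∀ x, kernelAt ω₀ x = ⊥)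
    {ωB : FormField EB B 2} (hsB : IsSmooth ωB)
    (hkB : ∀ b, Module.finrank ℝ (kernelAt ωB b) = 1) {τ : FormField EM M 2} (hτ : IsSmooth τ)
    (hτF : ∀ (e : Bundle.Trivialization F p) (he : e ∈ P.atlas) (b : B) (hb : b ∈ e.baseSet),
      (pullback (P.fibreIncl he hb) τ : FormField EF F 2) = ω₀) :
    ∃ K : ℝ, 0 < K ∧ ∀ x, Module.finrank ℝ
      (kernelAt (τ + K • (pullback p ωB : FormField EM M 2)) x) ≤ 1 := by
  have hlocal : ∀ b₀ ∈ (univ : Set B), ∀ᶠ z : ℝ × B in 𝓝 (0, b₀), ∀ x, p x = z.2 → z.1 ≠ 0 →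
      Module.finrank ℝ (kernelAt (τ + (z.1⁻¹ ^ 2) • (pullback p ωB : FormField EM M 2)) x) ≤ 1 := by
    intro b₀ _
    obtain ⟨e, he, hb₀⟩ := P.cover b₀
    have h1 := isCompact_univ.eventually_forall_of_forall_eventually (x₀ := ((0 : ℝ), b₀))
      (P := fun (z : ℝ × B) (f : F) => z.1 ≠ 0 → Module.finrank ℝ
        (kernelAt (τ + (z.1⁻¹ ^ 2) • (pullback p ωB : FormField EM M 2))
          (e.toOpenPartialHomeomorph.symm (z.2, f))) ≤ 1) fun f _ =>
      eventually_finrank_kernelAt_le_one_near P he hp hω₀ hsB hτ hb₀ (hkB b₀)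
        (hτF e he b₀ hb₀) f
    filter_upwards [h1, continuousAt_snd.eventually (e.open_baseSet.mem_nhds hb₀)]
      with z hz hze x hx hz0
    have h2 := hz (e x).2 (mem_univ _) hz0
    rwa [← hx, e.symm_apply_mk_proj (e.mem_source.2 (hx ▸ hze))] at h2
  have hglobal := isCompact_univ.eventually_forall_of_forall_eventually (x₀ := (0 : ℝ))
    (P := fun ε b => ∀ x, p x = b → ε ≠ 0 → Module.finrank ℝ
      (kernelAt (τ + (ε⁻¹ ^ 2) • (pullback p ωB : FormField EM M 2)) x) ≤ 1) hlocal
  obtain ⟨ε, hε, hεpos⟩ := ((hglobal.filter_mono nhdsWithin_le_nhds).and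
    (self_mem_nhdsWithin : Ioi (0 : ℝ) ∈ 𝓝[>] 0)).exists
  have hεpos' : (0 : ℝ) < ε := hεpos
  exact ⟨ε⁻¹ ^ 2, by positivity, fun x => hε (p x) (mem_univ _) x rfl hεpos'.ne'⟩

end GlobalRank

end DiffForm

/-! ### The theorem. -/

open DiffForm in
theorem mainTheorem7
    {EM EB EF : Type*}
    [NormedAddCommGroup EM] [NormedSpace ℝ EM] [FiniteDimensional ℝ EM]
    [NormedAddCommGroup EB] [NormedSpace ℝ EB] [FiniteDimensional ℝ EB]
    [NormedAddCommGroup EF] [NormedSpace ℝ EF] [FiniteDimensional ℝ EF]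
    {M B F : Type*}
    [TopologicalSpace M] [T2Space M] [Nonempty M] [ChartedSpace EM M] [IsManifold 𝓘(ℝ, EM) ∞ M]
    [TopologicalSpace B] [T2Space B] [CompactSpace B] [ChartedSpace EB B]
    [IsManifold 𝓘(ℝ, EB) ∞ B]
    [TopologicalSpace F] [T2Space F] [CompactSpace F] [ChartedSpace EF F]
    [IsManifold 𝓘(ℝ, EF) ∞ F]
    (p : C^∞⟮𝓘(ℝ, EM), M; 𝓘(ℝ, EB), B⟯)
    (ω₀ : closedForms EF F 2) (hω₀ : IsSymplectic (ω₀ : FormField EF F 2))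
    (P : SymplecticFibration EM EB p (ω₀ : FormField EF F 2))
    (ωB : closedForms EB B 2) (hωB : IsPresymplectic (ωB : FormField EB B 2))
    (u : DeRham EM M 2)
    (hu : ∀ (e : Bundle.Trivialization F p) (he : e ∈ P.atlas) (b : B) (hb : b ∈ e.baseSet),
      cohomPullback (P.fibreIncl he hb) u = cohomClass ω₀) :
    ∃ K : ℝ, 0 < K ∧ ∃ σ : closedForms EM M 2,
      IsPresymplectic (σ : FormField EM M 2) ∧
      (∀ (e : Bundle.Trivialization F p) (he : e ∈ P.atlas) (b : B) (hb : b ∈ e.baseSet),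
        pullback (P.fibreIncl he hb) (σ : FormField EM M 2) = (ω₀ : FormField EF F 2)) ∧
      cohomClass σ = u + K • cohomPullback p (cohomClass ωB) := by 
  obtain ⟨σ₀, rfl⟩ := exists_cohomClass_eq u
  have hp : ContMDiff 𝓘(ℝ, EM) 𝓘(ℝ, EB) ∞ p := p.contMDiff
  have hex : ∀ (e : Bundle.Trivialization F p) (he : e ∈ P.atlas) (b : B) (hb : b ∈ e.baseSet),
      ∃ α : FormField EF F 1, IsSmooth α ∧
        extD α = pullback (P.fibreIncl he hb) (σ₀ : FormField EM M 2) - (ω₀ : FormField EF F 2) :=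
    fun e he b hb => (cohomClass_eq_iff _ _).1 (hu e he b hb)
  obtain ⟨μ, hμ, hfib⟩ := P.exists_primitive_correction hp σ₀.2 hex
  have hdμ : extD μ ∈ closedForms EM M 2 := ⟨hμ.extD, extD_extD hμ⟩
  have hτ : (σ₀ : FormField EM M 2) - extD μ ∈ closedForms EM M 2 := sub_mem σ₀.2 hdμ
  have hpB : (pullback p (ωB : FormField EB B 2) : FormField EM M 2) ∈ closedForms EM M 2 :=
    pullback_mem_closedForms hp ωB.2
  obtain ⟨K, hK, hrank⟩ := P.exists_pos_finrank_kernelAt_le_one hp hω₀.2 ωB.2.1 hωB.2.2 hτ.1 hfib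
  have hσ : (σ₀ : FormField EM M 2) - extD μ + K • pullback p (ωB : FormField EB B 2) ∈
      closedForms EM M 2 := add_mem hτ (Submodule.smul_mem _ K hpB)
  refine ⟨K, hK, ⟨_, hσ⟩, ⟨hσ, ?_⟩, fun e he b hb => ?_, ?_⟩
  -- A point of `M` provides an isomorphism of `EM` with `EB × EF`; `dim F` is even because it
  -- carries a nondegenerate 2-form, and `dim B` is odd.
  · have hodd : Odd (Module.finrank ℝ EM) := by
      obtain ⟨x⟩ := ‹Nonempty M›
      obtain ⟨e, he, hb⟩ := P.cover (p x)
      have hq : (chartAt EB (p x) (p x), chartAt EF (e x).2 (e x).2) ∈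
          bundleParamSource EB EF e (p x) (e x).2 := by
        refine ⟨⟨mem_chart_target EB (p x), ?_⟩, mem_chart_target EF (e x).2⟩
        change (chartAt EB (p x)).symm (chartAt EB (p x) (p x)) ∈ e.baseSet
        rwa [(chartAt EB (p x)).left_inv (mem_chart_source EB (p x))]
      obtain ⟨A, -⟩ := exists_tmap_bundleParam_equiv P he hp hq
      have heven : Even (Module.finrank ℝ EF) :=
        even_finrank_of_nondegenerate (evalAt (ω₀ : FormField EF F 2) (e x).2) fun v hv => by
          have h1 : v ∈ (kernelAt (ω₀ : FormField EF F 2) (e x).2 : Submodule ℝ EF) := hv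
          have h2 : v ∈ (⊥ : Submodule ℝ EF) := hω₀.2 (e x).2 ▸ h1
          exact h2
      rw [← A.finrank_eq, Module.finrank_prod]
      exact hωB.2.1.add_even heven
    exact ⟨hodd, fun x => finrank_kernelAt_eq_one hodd (hrank x)⟩
  -- `p` is constant on each fibre, so the multiple of `p^*ωB` does not disturb the fibre
  -- restrictions.
  · have hconst : (pullback (P.fibreIncl he hb) (pullback p (ωB : FormField EB B 2) :
        FormField EM M 2) : FormField EF F 2) = 0 := by
      rw [← pullback_comp (fun f => (hp _).mdifferentiableAt (by simp))
        (fun f => ((P.fibreIncl he hb).contMDiff f).mdifferentiableAt (by simp)),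
        show p ∘ P.fibreIncl he hb = fun _ => b from funext (P.proj_fibreIncl he hb)]
      refine formField_ext fun f => ?_
      have h0 : tmap EF EB (fun _ : F => b) f = 0 := mfderiv_const
      rw [evalAt_pullback, h0]
      ext v
      exact (evalAt (ωB : FormField EB B 2) b).map_coord_zero 0 rfl
    change pullback (P.fibreIncl he hb)
      ((σ₀ : FormField EM M 2) - extD μ + K • pullback p (ωB : FormField EB B 2)) = _
    rw [pullback_add, pullback_smul, hconst, smul_zero, add_zero, hfib]
  · rw [cohomPullback_cohomClass]
    have hsum : cohomClass σ₀ + K • cohomClass (⟨_, hpB⟩ : closedForms EM M 2) =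
        cohomClass (σ₀ + K • (⟨_, hpB⟩ : closedForms EM M 2)) := rfl
    refine Eq.trans ?_ hsum.symm
    -- The final form differs from `σ₀ + K p^*ωB` by `-dμ`, whence the primitive `-μ`.
    refine (cohomClass_eq_iff _ _).2 ⟨(-1 : ℝ) • μ, hμ.smul _, ?_⟩
    rw [extD_smul]
    change _ = (σ₀ : FormField EM M 2) - extD μ + K • pullback p (ωB : FormField EB B 2) -
      ((σ₀ : FormField EM M 2) + K • pullback p (ωB : FormField EB B 2))
    rw [neg_one_smul]
    abel
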